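/- Consider online scheduling on $N\ge 2$ identical machines in continuous time. An instance $\omega$ consists of $n\ge 1$ jobs; job $i$ has a release date $r_i\ge 0$ and $n_i\ge 1$ tasks with processing times $p_i^{(\ell)}>0$, each task being either preemptive (it may be interrupted and resumed later, possibly on another machine) or non-preemptive (once started, it is run to completion without interruption on one machine). A machine serves at most one task at a time and a task is served by at most one machine at a time; different tasks of the same job either may or may not be processed in parallel (two scenarios; the result holds in each). Let $C_i$ be the time at which all tasks of job $i$ are completed; the cost of a schedule is the total response time $\sum_i (C_i-r_i)$. Put $p_i=\sum_\ell p_i^{(\ell)}$, $\alpha(\omega)=\max_i p_i/\min_i p_i$, and $\beta(\omega)=\eta/\min_i p_i$, where $\eta$ is the largest processing time of a non-preemptive task ($\eta=0$ if there is none). A deterministic online algorithm $A$ assigns to each instance a feasible schedule whose actions up to time $t$ depend only on the jobs released up to time $t$. It is work-conserving if no machine is ever idle while some feasible task is awaiting execution, i.e. a task that is released, not completed, not in service, and (if tasks of one job may not be processed in parallel) belongs to a job none of whose tasks is in service. For real numbers $a\ge1$ and $0\le b\le a$ let $$\mathcal{CR}_A(a,b)=\sup\Big\{\frac{\mathrm{Cost}_A(\omega)}{\mathrm{Cost}_{\mathrm{OPT}}(\omega)}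 : \alpha(\omega)=a,\ \beta(\omega)=b\Big\},$$ where $\mathrm{Cost}_{\mathrm{OPT}}(\omega)$ is the infimum of the costs of all feasible offline schedules for $\omega$ (in the same scenario and on the same number of machines). **Proposition.** For every $\varepsilon>0$ there is a constant $c>0$, depending only on $\varepsilon$, such that in both scenarios, for every $N\ge 2$, every work-conserving online algorithm $A$, and all real $a\ge 1$ and $0\le b\le a$ (with $b\ge 1$ in case $\varepsilon>1$), $$\mathcal{CR}_A(a,b)\ \ge\ c\,\big(\log a+b^{\,1-\varepsilon}\big).$$ That is, every work-conserving algorithm has competitive ratio $\Omega(\log\alpha+\beta^{1-\varepsilon})$. -/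

import Mathlib

open MeasureTheory
open scoped ENNReal

namespace MPMS

noncomputable section

/-- A task: its processing time, and whether it may be preempted. -/
structure Task where
  size : ℝ
  size_pos : 0 < size
  preemptive : Bool

/-- A job: its releasing date and its (nonempty, finite) list of tasks. -/
structure Job where
  release : ℝ
  release_nonneg : 0 ≤ release
  tasks : List Task
  tasks_ne : tasks ≠ []

/-- The workload of a job: the sum of the processing times of its tasks. -/
def Job.workload (J : Job) : ℝ := (J.tasks.map Task.size).sum

/-- An input instance: finitely many (at least one) jobs, numbered in order of arrival. -/
structure Input where
  jobs : List Job
  jobs_ne : jobs ≠ []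
  sorted : jobs.Pairwise (fun J K => J.release ≤ K.release)

namespace Input

/-- `max_i p_i` (a supremum over a finite nonempty family). -/
def maxWorkload (ω : Input) : ℝ := ⨆ i : Fin ω.jobs.length, ω.jobs[i].workload

/-- `min_i p_i` (an infimum over a finite nonempty family). -/
def minWorkload (ω : Input) : ℝ := ⨅ i : Fin ω.jobs.length, ω.jobs[i].workload

/-- The maximum processing time of a non-preemptive task; it is `0` if there is none. -/
def eta (ω : Input) : ℝ :=
  sSup {x : ℝ | ∃ J ∈ ω.jobs, ∃ τ ∈ J.tasks, τ.preemptive = false ∧ x = τ.size}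

/-- The ratio of the maximum to the minimum job workload. -/
def alpha (ω : Input) : ℝ := ω.maxWorkload / ω.minWorkload

/-- The ratio of the maximum non-preemptive task to the minimum job workload. -/
def beta (ω : Input) : ℝ := ω.eta / ω.minWorkload

/-- `ω.IsTask k J τ`: the pair `k = (i, l)` names task `τ`, the `l`-th task of the `i`-th job `J`. -/
def IsTask (ω : Input) (k : ℕ × ℕ) (J : Job) (τ : Task) : Prop :=
  ω.jobs[k.1]? = some J ∧ J.tasks[k.2]? = some τ

/-- The two instances have the same jobs (with the same numbers) released up to time `t`. -/
def AgreeUpTo (ω ω' : Input) (t : ℝ) : Prop :=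
  ∀ (i : ℕ) (J : Job), J.release ≤ t → (ω.jobs[i]? = some J ↔ ω'.jobs[i]? = some J)

end Input

/-- A schedule on `N` machines in continuous time: which task, if any, each machine serves at
each time. -/
def Schedule (N : ℕ) : Type := ℝ → Fin N → Option (ℕ × ℕ)

namespace Schedule

variable {N : ℕ}

/-- The amount of service that task `k` has received before time `t`. -/
def served (S : Schedule N) (k : ℕ × ℕ) (t : ℝ) : ℝ :=
  volume.real ({u : ℝ | ∃ m, S u m = some k} ∩ Set.Ico 0 t)

/-- Feasibility. The flag `parallel` says whether different tasks of one job may be served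
simultaneously. -/
structure Feasible (parallel : Bool) (ω : Input) (S : Schedule N) : Prop where
  measurable : ∀ (m : Fin N) (k : ℕ × ℕ), MeasurableSet {t : ℝ | S t m = some k}
  /-- Only tasks that have been released and are not yet completed are served. -/
  alive : ∀ (t : ℝ) (m : Fin N) (k : ℕ × ℕ), S t m = some k →
    ∃ J τ, ω.IsTask k J τ ∧ J.release ≤ t ∧ S.served k t < τ.size
  /-- A task is served by at most one machine at a time. -/
  one_machine : ∀ (t : ℝ) (m m' : Fin N) (k : ℕ × ℕ),
    S t m = some k → S t m' = some k → m = m'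
  /-- In the scenario without parallelism, a job is served by at most one machine at a time. -/
  sequential : parallel = false → ∀ (t : ℝ) (m m' : Fin N) (i l l' : ℕ),
    S t m = some (i, l) → S t m' = some (i, l') → m = m'
  /-- A non-preemptive task, once started, is run to completion on its machine. -/
  nonpreemptive : ∀ (k : ℕ × ℕ) (J : Job) (τ : Task), ω.IsTask k J τ → τ.preemptive = false →
    (∃ t m, S t m = some k) →
    ∃ (s : ℝ) (m : Fin N), ∀ (u : ℝ) (m' : Fin N),
      S u m' = some k ↔ m' = m ∧ s ≤ u ∧ u < s + τ.size

/-- The completion time of task `τ` with name `k` (`∞` if it is never completed). -/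
def taskCompletion (S : Schedule N) (k : ℕ × ℕ) (τ : Task) : ℝ≥0∞ :=
  ⨅ (t : ℝ) (_ : τ.size ≤ S.served k t), ENNReal.ofReal t

/-- The completion time of job `J` with number `i`: the maximum over its tasks. -/
def jobCompletion (S : Schedule N) (i : ℕ) (J : Job) : ℝ≥0∞ :=
  ⨆ (l : Fin J.tasks.length), S.taskCompletion (i, (l : ℕ)) J.tasks[l]

/-- The total response time `∑ (C_j - r_j)`. -/
def cost (ω : Input) (S : Schedule N) : ℝ≥0∞ :=
  ∑ i : Fin ω.jobs.length, (S.jobCompletion i ω.jobs[i] - ENNReal.ofReal ω.jobs[i].release)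

/-- Task `k` is a feasible task awaiting execution at time `t`: it is released, not completed, not
in service, and, in the scenario without parallelism, no task of its job is in service. -/
def Awaiting (parallel : Bool) (ω : Input) (S : Schedule N) (t : ℝ) (k : ℕ × ℕ) : Prop :=
  (∃ J τ, ω.IsTask k J τ ∧ J.release ≤ t ∧ S.served k t < τ.size) ∧
  (∀ m, S t m ≠ some k) ∧
  (parallel = false → ∀ m l, S t m ≠ some (k.1, l))

end Schedule

/-- The optimal offline cost of an instance on `N` machines. -/
def optCost (parallel : Bool) (N : ℕ) (ω : Input) : ℝ≥0∞ :=
  ⨅ (S : Schedule N) (_ : S.Feasible parallel ω), S.cost ω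

/-- A (deterministic) online scheduling algorithm: it produces a feasible schedule for each
instance, and what it does up to time `t` depends only on the jobs released up to time `t`. -/
structure OnlineAlgorithm (parallel : Bool) (N : ℕ) where
  run : Input → Schedule N
  feasible : ∀ ω, (run ω).Feasible parallel ω
  nonanticipating : ∀ (ω ω' : Input) (t : ℝ), ω.AgreeUpTo ω' t → ∀ s ≤ t, run ω s = run ω' s

namespace OnlineAlgorithm

variable {parallel : Bool} {N : ℕ}

/-- No machine is ever idle while a feasible task is awaiting execution. -/
def WorkConserving (A : OnlineAlgorithm parallel N) : Prop :=
  ∀ (ω : Input) (t : ℝ) (m : Fin N), A.run ω t m = none →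
    ¬ ∃ k, (A.run ω).Awaiting parallel ω t k

/-- The competitive ratio of an online algorithm over a class `Ω` of instances. -/
def competitiveRatio (A : OnlineAlgorithm parallel N) (Ω : Set Input) : ℝ≥0∞ :=
  ⨆ ω ∈ Ω, (A.run ω).cost ω / optCost parallel N ω

end OnlineAlgorithm

end

end MPMS

/-! The competitive ratio is bounded below by 1/3, by b/6 and by log a / 144 separately, and b ^ (1
- ε) ≤ max 1 b, so c need not even depend on ε. Only the bound b/6 uses work conservation.

All three bounds rest on a backlog principle, `exists_input_of_backlog`. Suppose that at time T the
algorithm still has θN units of work, each job counting for at most one unit, while an offline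
schedule has finished everything except a few jobs that it can postpone. Now let N unit jobs arrive
per unit of time. They offset the whole capacity, so at every later step the algorithm has at least
θN unfinished jobs. Offline, the stream jobs are served on arrival and the postponed jobs run after
the stream, at a cost of about 2N per unit of time. A long stream makes all other costs negligible.

For b/6 (`div_six_le_competitiveRatio`), N non-preemptive jobs of length b block all machines while
about Nb unit jobs wait.

For log a (`div_le_competitiveRatio_of_phases`), phase i has length 2H_i and starts with ⌊N/2⌋
preemptive jobs of length 2H_i and N H_i unit jobs. Offline, all of them fit into the phase;
alternatively the unit jobs are done by its middle and the long jobs are postponed. If the algorithm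
has more than KN capped units left at the middle of some phase, the stream starts there. Otherwise
almost all of its first-half capacity went to unit jobs, so the long jobs end the phase with nearly
H_i units each. As H_i drops by a factor 12 per phase, a later phase can remove only a small part of
the older backlog. After K phases about KN/6 unfinished jobs remain, and K of order log a is
possible since the longest job has length 2K·12^K. -/

namespace MPMS

noncomputable section

/-! ### Service received by a task -/

namespace Schedule

variable {N : ℕ} {S : Schedule N}

/-- The set of times at which task `k` is in service. -/
def serviceTimes (S : Schedule N) (k : ℕ × ℕ) : Set ℝ := {u : ℝ | ∃ m, S u m = some k}

lemma served_eq_add (k : ℕ × ℕ) {s t : ℝ} (hs : 0 ≤ s) (hst : s ≤ t) :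
    S.served k t = S.served k s + volume.real (S.serviceTimes k ∩ Set.Ico s t) := by
  unfold served serviceTimes
  have h1 : ({u : ℝ | ∃ m, S u m = some k} ∩ Set.Ico 0 t) ∩ Set.Ico 0 s
      = {u : ℝ | ∃ m, S u m = some k} ∩ Set.Ico 0 s := by
    rw [Set.inter_assoc, Set.Ico_inter_Ico]; simp [hst]
  have h2 : ({u : ℝ | ∃ m, S u m = some k} ∩ Set.Ico 0 t) \ Set.Ico 0 s
      = {u : ℝ | ∃ m, S u m = some k} ∩ Set.Ico s t := by
    ext u
    simp only [Set.mem_sdiff, Set.mem_inter_iff, Set.mem_Ico, not_and, not_lt]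
    constructor
    · rintro ⟨⟨h, h0, ht⟩, h'⟩; exact ⟨h, h' h0, ht⟩
    · rintro ⟨h, h0, ht⟩; exact ⟨⟨h, hs.trans h0, ht⟩, fun _ => h0⟩
  have hfin : volume ({u : ℝ | ∃ m, S u m = some k} ∩ Set.Ico 0 t) ≠ ⊤ :=
    measure_ne_top_of_subset Set.inter_subset_right (by simp)
  rw [← measureReal_inter_add_sdiff (s := {u : ℝ | ∃ m, S u m = some k} ∩ Set.Ico 0 t)
    (measurableSet_Ico (a := (0 : ℝ)) (b := s)) hfin, h1, h2]

lemma served_mono (k : ℕ × ℕ) {s t : ℝ} (hs : 0 ≤ s) (hst : s ≤ t) :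
    S.served k s ≤ S.served k t := by
  rw [served_eq_add k hs hst]
  exact le_add_of_nonneg_right measureReal_nonneg

lemma served_nonneg (k : ℕ × ℕ) (t : ℝ) : 0 ≤ S.served k t := measureReal_nonneg

lemma served_le_add (k : ℕ × ℕ) {s t : ℝ} (hs : 0 ≤ s) (hst : s ≤ t) :
    S.served k t ≤ S.served k s + (t - s) := by
  rw [served_eq_add k hs hst]
  gcongr
  calc volume.real (S.serviceTimes k ∩ Set.Ico s t) ≤ volume.real (Set.Ico s t) :=
        measureReal_mono Set.inter_subset_right (by simp)
    _ = t - s := by rw [Real.volume_real_Ico_of_le hst]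

/-- `N` machines provide at most `N * (t - s)` units of service during `[s, t)`. -/
lemma Feasible.sum_served_sub_le {parallel : Bool} {ω : Input} (hS : S.Feasible parallel ω)
    (I : Finset ℕ) {s t : ℝ} (hs : 0 ≤ s) (hst : s ≤ t) :
    ∑ i ∈ I, (S.served (i, 0) t - S.served (i, 0) s) ≤ N * (t - s) := by
  have h1 : ∀ i ∈ I, S.served (i, 0) t - S.served (i, 0) s
      ≤ ∑ m : Fin N, volume.real ({u : ℝ | S u m = some (i, 0)} ∩ Set.Ico s t) := by
    intro i _
    rw [served_eq_add (i, 0) hs hst, add_sub_cancel_left]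
    have : S.serviceTimes (i, 0) ∩ Set.Ico s t
        = ⋃ m, ({u : ℝ | S u m = some (i, 0)} ∩ Set.Ico s t) := by
      ext u; simp [serviceTimes]
    rw [this]
    exact measureReal_iUnion_fintype_le _
  refine (Finset.sum_le_sum h1).trans ?_
  rw [Finset.sum_comm]
  have h2 : ∀ m ∈ (Finset.univ : Finset (Fin N)),
      ∑ i ∈ I, volume.real ({u : ℝ | S u m = some (i, 0)} ∩ Set.Ico s t) ≤ t - s := by
    intro m _
    rw [← measureReal_biUnion_finset
      (h := fun i _ => measure_ne_top_of_subset Set.inter_subset_right (by simp))]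
    · calc _ ≤ volume.real (Set.Ico s t) :=
            measureReal_mono (Set.iUnion₂_subset fun i _ => Set.inter_subset_right) (by simp)
        _ = t - s := by rw [Real.volume_real_Ico_of_le hst]
    · intro i _ j _ hij
      refine Set.disjoint_left.2 fun u hu hu' => hij ?_
      have := hu.1.symm.trans hu'.1
      simpa using this
    · exact fun i _ => (hS.measurable m (i, 0)).inter measurableSet_Ico
  refine (Finset.sum_le_sum h2).trans ?_
  rw [Finset.sum_const, Finset.card_univ, Fintype.card_fin, nsmul_eq_mul]

lemma served_eq_zero {k : ℕ × ℕ} {t : ℝ} (h : ∀ u < t, ∀ m, S u m ≠ some k) :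
    S.served k t = 0 := by
  unfold served
  have : {u : ℝ | ∃ m, S u m = some k} ∩ Set.Ico 0 t = ∅ := by
    ext u
    simp only [Set.mem_inter_iff, Set.mem_ofPred_eq, Set.mem_Ico, Set.mem_empty_iff_false, iff_false]
    rintro ⟨⟨m, hm⟩, -, hu⟩
    exact h u hu m hm
  rw [this]; simp

lemma Feasible.served_eq_zero_of_le_release {parallel : Bool} {ω : Input}
    (hS : S.Feasible parallel ω) {i l : ℕ} {J : Job} (hJ : ω.jobs[i]? = some J) {t : ℝ}
    (ht : t ≤ J.release) : S.served (i, l) t = 0 := by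
  refine served_eq_zero fun u hu m hm => ?_
  obtain ⟨J', τ, hk, hr, -⟩ := hS.alive u m _ hm
  have : J = J' := by simpa using hJ.symm.trans hk.1
  subst this
  linarith

lemma served_congr {S' : Schedule N} {t : ℝ} (h : ∀ u < t, S u = S' u) (k : ℕ × ℕ) :
    S.served k t = S'.served k t := by
  unfold served
  congr 1
  ext u
  simp only [Set.mem_inter_iff, Set.mem_ofPred_eq, Set.mem_Ico]
  constructor <;> rintro ⟨⟨m, hm⟩, h0, hu⟩
  · exact ⟨⟨m, by rw [← h u hu]; exact hm⟩, h0, hu⟩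
  · exact ⟨⟨m, by rw [h u hu]; exact hm⟩, h0, hu⟩

/-- A task that is not completed by time `t` has completion time at least `t`. -/
lemma le_taskCompletion {k : ℕ × ℕ} {τ : Task} {t : ℝ}
    (h : S.served k t < τ.size) : ENNReal.ofReal t ≤ S.taskCompletion k τ := by
  refine le_iInf₂ fun u hu => ?_
  by_cases htu : t ≤ u
  · exact ENNReal.ofReal_le_ofReal htu
  · exfalso
    push Not at htu
    rcases le_or_gt 0 u with h0 | h0
    · linarith [served_mono (S := S) k h0 htu.le]
    · have : S.served k u = 0 := by
        unfold served
        rw [Set.Ico_eq_empty (by linarith)]; simp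
      linarith [τ.size_pos]

end Schedule

/-! ### Residual and capped work -/

/-- The processing time of the first task of a job. -/
def Job.firstSize (J : Job) : ℝ := (J.tasks.head J.tasks_ne).size

lemma Job.isTask_zero {ω : Input} {i : ℕ} {J : Job} (h : ω.jobs[i]? = some J) :
    ω.IsTask (i, 0) J (J.tasks.head J.tasks_ne) := by
  refine ⟨h, ?_⟩
  simp [← List.head?_eq_getElem?, List.head?_eq_some_head J.tasks_ne]

/-- The part of the first task of job `i` that is still to be served at time `t`. -/
def Input.residual {N : ℕ} (ω : Input) (S : Schedule N) (i : ℕ) (t : ℝ) : ℝ :=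
  (ω.jobs[i]?).elim 0 Job.firstSize - S.served (i, 0) t

/-- Tracking the first task alone bounds the completion time from below. Nothing is lost: every job
of the adversary except a final one has a single task. -/
lemma Schedule.le_jobCompletion {N : ℕ} {S : Schedule N} {i : ℕ} {J : Job} {t : ℝ}
    (h : S.served (i, 0) t < J.firstSize) : ENNReal.ofReal t ≤ S.jobCompletion i J := by
  have hpos : 0 < J.tasks.length := List.length_pos_of_ne_nil J.tasks_ne
  refine le_trans ?_ (le_iSup _ (⟨0, hpos⟩ : Fin J.tasks.length))
  refine le_taskCompletion ?_
  simpa [Job.firstSize, List.head_eq_getElem] using h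

/-- The remaining processing time `x`, capped to the interval `[0, c]`. -/
def cap (c x : ℝ) : ℝ := max 0 (min x c)

lemma cap_nonneg (c x : ℝ) : 0 ≤ cap c x := le_max_left _ _

lemma cap_le {c : ℝ} (hc : 0 ≤ c) (x : ℝ) : cap c x ≤ c := max_le hc (min_le_right _ _)

lemma le_cap {c x : ℝ} (h : x ≤ c) : x ≤ cap c x := by
  unfold cap; rw [min_eq_left h]; exact le_max_right _ _

lemma cap_eq_zero {c x : ℝ} (h : x ≤ 0) : cap c x = 0 :=
  max_eq_left ((min_le_left _ _).trans h)

/-- Capping is monotone and 1-Lipschitz, so service lowers a capped residual by at most its own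
amount. -/
lemma cap_sub_le {d : ℝ} (hd : 0 ≤ d) (c x : ℝ) : cap c x - d ≤ cap c (x - d) := by
  unfold cap
  rcases le_total x c with h | h <;> rcases le_total (x - d) c with h' | h' <;>
    simp only [min_eq_left, min_eq_right, h, h'] <;>
    rcases le_total 0 x with h0 | h0 <;> rcases le_total 0 c with h1 | h1 <;>
    rcases le_total 0 (x - d) with h2 | h2 <;>
    simp only [max_eq_left, max_eq_right, h0, h1, h2] <;> linarith

lemma cap_mono {c : ℝ} {x y : ℝ} (h : x ≤ y) : cap c x ≤ cap c y :=
  max_le_max le_rfl (min_le_min h le_rfl)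

lemma cap_le_mul_cap {r c : ℝ} (hr : 1 ≤ r) (x : ℝ) : cap (r * c) x ≤ r * cap c x := by
  rcases le_total x 0 with h | h
  · rw [cap_eq_zero h, cap_eq_zero h]; simp
  · unfold cap
    refine max_le (by positivity) ?_
    calc min x (r * c) ≤ min (r * x) (r * c) := min_le_min (by nlinarith) le_rfl
      _ = r * min x c := by rw [mul_min_of_nonneg _ _ (by linarith)]
      _ ≤ _ := by gcongr; exact le_max_right _ _

end

/-! ### Offline schedules given by placed jobs -/

noncomputable section

/-- A job together with a machine and a starting time; its tasks are served there one after the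
other without interruption. -/
structure Placed (N : ℕ) where
  job : Job
  mach : Fin N
  start : ℝ

namespace Placed

variable {N : ℕ}

/-- The completion time of a placed job. -/
def fin (p : Placed N) : ℝ := p.start + p.job.workload

/-- The starting time of task `l` of a placed job. -/
def taskStart (p : Placed N) (l : ℕ) : ℝ := p.start + ((p.job.tasks.take l).map Task.size).sum

/-- Two placed jobs do not overlap. -/
def Compatible (p q : Placed N) : Prop := p.mach = q.mach → p.fin ≤ q.start ∨ q.fin ≤ p.start

lemma Compatible.symm {p q : Placed N} (h : p.Compatible q) : q.Compatible p :=
  fun e => (h e.symm).symm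

/-- A list of placed jobs describes a schedule. -/
structure Valid (L : List (Placed N)) : Prop where
  release_le : ∀ p ∈ L, p.job.release ≤ p.start
  compatible : L.Pairwise Compatible

end Placed

lemma sum_map_size_nonneg (l : List Task) : 0 ≤ (l.map Task.size).sum := by
  refine List.sum_nonneg fun x hx => ?_
  obtain ⟨τ, -, rfl⟩ := List.mem_map.1 hx
  exact τ.size_pos.le

lemma Job.workload_pos (J : Job) : 0 < J.workload := by
  unfold Job.workload
  obtain ⟨τ, l, h⟩ := List.exists_cons_of_ne_nil J.tasks_ne
  rw [h, List.map_cons, List.sum_cons]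
  linarith [τ.size_pos, sum_map_size_nonneg l]

namespace Placed

variable {N : ℕ}

lemma start_le_taskStart (p : Placed N) (l : ℕ) : p.start ≤ p.taskStart l :=
  le_add_of_nonneg_right (sum_map_size_nonneg _)

lemma taskStart_succ (p : Placed N) {l : ℕ} {τ : Task} (h : p.job.tasks[l]? = some τ) :
    p.taskStart (l + 1) = p.taskStart l + τ.size := by
  unfold taskStart
  rw [List.take_add_one, h]
  simp [add_assoc]

lemma taskStart_mono (p : Placed N) {l l' : ℕ} (h : l ≤ l') : p.taskStart l ≤ p.taskStart l' := by
  unfold taskStart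
  have : p.job.tasks.take l' = p.job.tasks.take l ++ (p.job.tasks.take l').drop l := by
    conv_lhs => rw [← List.take_append_drop l (p.job.tasks.take l')]
    rw [List.take_take, min_eq_left h]
  rw [this, List.map_append, List.sum_append]
  linarith [sum_map_size_nonneg ((p.job.tasks.take l').drop l)]

lemma taskStart_add_size_le (p : Placed N) {l : ℕ} {τ : Task} (h : p.job.tasks[l]? = some τ) :
    p.taskStart l + τ.size ≤ p.fin := by
  rw [← p.taskStart_succ h]
  have hl : l + 1 ≤ p.job.tasks.length := (List.getElem?_eq_some_iff.1 h).1
  refine (p.taskStart_mono hl).trans ?_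
  simp [taskStart, fin, Job.workload]

/-- Task `k` is placed on machine `m` at time `t`. -/
def Occupies (L : List (Placed N)) (t : ℝ) (m : Fin N) (k : ℕ × ℕ) : Prop :=
  ∃ p τ, L[k.1]? = some p ∧ p.job.tasks[k.2]? = some τ ∧ p.mach = m ∧
    p.taskStart k.2 ≤ t ∧ t < p.taskStart k.2 + τ.size

lemma Valid.occupies_unique {L : List (Placed N)} (hL : Valid L) {t : ℝ} {m : Fin N}
    {k k' : ℕ × ℕ} (h : Occupies L t m k) (h' : Occupies L t m k') : k = k' := by
  obtain ⟨i, l⟩ := k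
  obtain ⟨i', l'⟩ := k'
  obtain ⟨p, τ, hp, hτ, hm, h1, h2⟩ := h
  obtain ⟨p', τ', hp', hτ', hm', h1', h2'⟩ := h'
  dsimp only at *
  have hii : i = i' := by
    by_contra hne
    have key : p.Compatible p' := by
      have hpw := List.pairwise_iff_getElem.1 hL.compatible
      obtain ⟨hi, rfl⟩ := List.getElem?_eq_some_iff.1 hp
      obtain ⟨hi', rfl⟩ := List.getElem?_eq_some_iff.1 hp'
      rcases lt_or_gt_of_ne hne with hlt | hlt
      · exact hpw i i' hi hi' hlt
      · exact (hpw i' i hi' hi hlt).symm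
    rcases key (hm.trans hm'.symm) with h | h
    · linarith [p.taskStart_add_size_le hτ, p'.start_le_taskStart l']
    · linarith [p'.taskStart_add_size_le hτ', p.start_le_taskStart l]
  subst hii
  obtain rfl : p = p' := by simpa using hp.symm.trans hp'
  have hll : l = l' := by
    by_contra hne
    rcases lt_or_gt_of_ne hne with hlt | hlt
    · linarith [p.taskStart_mono (Nat.succ_le_of_lt hlt), p.taskStart_succ hτ]
    · linarith [p.taskStart_mono (Nat.succ_le_of_lt hlt), p.taskStart_succ hτ']
  rw [hll]

open Classical in
/-- The schedule described by a list of placed jobs. -/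
def toSchedule (L : List (Placed N)) : Schedule N := fun t m =>
  if h : ∃ k, Occupies L t m k then some h.choose else none

lemma Valid.toSchedule_eq_some {L : List (Placed N)} (hL : Valid L) (t : ℝ) (m : Fin N)
    (k : ℕ × ℕ) : toSchedule L t m = some k ↔ Occupies L t m k := by
  unfold toSchedule
  split_ifs with h
  · rw [Option.some_inj]
    constructor
    · rintro rfl; exact h.choose_spec
    · exact fun hk => hL.occupies_unique h.choose_spec hk
  · simp only [false_iff]
    exact fun hk => h ⟨k, hk⟩

lemma Valid.toSchedule_iff {L : List (Placed N)} (hL : Valid L) {k : ℕ × ℕ} {p : Placed N}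
    {τ : Task} (hp : L[k.1]? = some p) (hτ : p.job.tasks[k.2]? = some τ) (t : ℝ) (m : Fin N) :
    toSchedule L t m = some k ↔
      m = p.mach ∧ p.taskStart k.2 ≤ t ∧ t < p.taskStart k.2 + τ.size := by
  rw [hL.toSchedule_eq_some]
  constructor
  · rintro ⟨p', τ', hp', hτ', hm, h1, h2⟩
    obtain rfl : p = p' := by simpa using hp.symm.trans hp'
    obtain rfl : τ = τ' := by simpa using hτ.symm.trans hτ'
    exact ⟨hm.symm, h1, h2⟩
  · rintro ⟨hm, h1, h2⟩
    exact ⟨p, τ, hp, hτ, hm.symm, h1, h2⟩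

lemma Valid.served_eq {L : List (Placed N)} (hL : Valid L) {k : ℕ × ℕ} {p : Placed N}
    {τ : Task} (hp : L[k.1]? = some p) (hτ : p.job.tasks[k.2]? = some τ) (t : ℝ) :
    (toSchedule L).served k t
      = volume.real (Set.Ico (p.taskStart k.2) (min (p.taskStart k.2 + τ.size) t)) := by
  unfold Schedule.served
  congr 1
  have h0 : 0 ≤ p.taskStart k.2 :=
    (p.job.release_nonneg.trans (hL.release_le p (List.mem_of_getElem? hp))).trans
      (p.start_le_taskStart _)
  ext u
  simp only [Set.mem_inter_iff, Set.mem_ofPred_eq, Set.mem_Ico, hL.toSchedule_iff hp hτ]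
  constructor
  · rintro ⟨⟨m, -, h1, h2⟩, -, h3⟩
    exact ⟨h1, lt_min h2 h3⟩
  · rintro ⟨h1, h2⟩
    exact ⟨⟨p.mach, rfl, h1, h2.trans_le (min_le_left _ _)⟩, h0.trans h1,
      h2.trans_le (min_le_right _ _)⟩

/-- A placed job runs its tasks back to back on one machine. Hence the schedule respects
non-preemption and is feasible with and without parallelism. -/
lemma Valid.feasible {L : List (Placed N)} (hL : Valid L) {ω : Input}
    (hω : ω.jobs = L.map Placed.job) (parallel : Bool) :
    (toSchedule L).Feasible parallel ω := by
  have hmem : ∀ (i : ℕ) (J : Job), ω.jobs[i]? = some J → ∃ p : Placed N, L[i]? = some p ∧ p.job = J := by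
    intro i J h
    rw [hω, List.getElem?_map] at h
    simpa using h
  constructor
  · intro m k
    by_cases hk : ∃ (p : Placed N) (τ : Task), L[k.1]? = some p ∧ p.job.tasks[k.2]? = some τ
    · obtain ⟨p, τ, hp, hτ⟩ := hk
      simp only [hL.toSchedule_iff hp hτ]
      by_cases hm : m = p.mach
      · simp only [hm, true_and]; exact measurableSet_Ico
      · simp [hm]
    · have : {t : ℝ | toSchedule L t m = some k} = ∅ := by
        ext t
        simp only [Set.mem_ofPred_eq, Set.mem_empty_iff_false, iff_false, hL.toSchedule_eq_some]
        rintro ⟨p, τ, hp, hτ, -⟩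
        exact hk ⟨p, τ, hp, hτ⟩
      rw [this]; exact MeasurableSet.empty
  · intro t m k h
    obtain ⟨p, τ, hp, hτ, hm, h1, h2⟩ := (hL.toSchedule_eq_some _ _ _).1 h
    refine ⟨p.job, τ, ⟨by simp [hω, hp], hτ⟩, ?_, ?_⟩
    · exact ((hL.release_le p (List.mem_of_getElem? hp)).trans (p.start_le_taskStart _)).trans h1
    · rw [hL.served_eq hp hτ, min_eq_right h2.le, Real.volume_real_Ico_of_le h1]
      linarith
  · intro t m m' k h h'
    obtain ⟨p, τ, hp, hτ, hm, -⟩ := (hL.toSchedule_eq_some _ _ _).1 h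
    obtain ⟨p', τ', hp', hτ', hm', -⟩ := (hL.toSchedule_eq_some _ _ _).1 h'
    obtain rfl : p = p' := by simpa using hp.symm.trans hp'
    exact hm.symm.trans hm'
  · intro _ t m m' i l l' h h'
    obtain ⟨p, τ, hp, hτ, hm, -⟩ := (hL.toSchedule_eq_some _ _ _).1 h
    obtain ⟨p', τ', hp', hτ', hm', -⟩ := (hL.toSchedule_eq_some _ _ _).1 h'
    obtain rfl : p = p' := by simpa using hp.symm.trans hp'
    exact hm.symm.trans hm'
  · rintro k J τ ⟨hJ, hτ⟩ _ _
    obtain ⟨p, hp, rfl⟩ := hmem _ _ hJ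
    exact ⟨p.taskStart k.2, p.mach, fun u m' => hL.toSchedule_iff hp hτ u m'⟩

lemma Valid.jobCompletion_le {L : List (Placed N)} (hL : Valid L) {i : ℕ} {p : Placed N}
    (hp : L[i]? = some p) :
    (toSchedule L).jobCompletion i p.job ≤ ENNReal.ofReal p.fin := by
  refine iSup_le fun l => ?_
  have hτ : p.job.tasks[((i, (l : ℕ)) : ℕ × ℕ).2]? = some p.job.tasks[l] := by simp
  refine (iInf₂_le (p.taskStart l + p.job.tasks[l].size) ?_).trans
    (ENNReal.ofReal_le_ofReal (p.taskStart_add_size_le hτ))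
  rw [hL.served_eq (k := (i, (l : ℕ))) hp hτ]
  simp only [min_self]
  rw [Real.volume_real_Ico_of_le (by linarith [p.job.tasks[l].size_pos])]
  simp

lemma Valid.optCost_le {L : List (Placed N)} (hL : Valid L) {ω : Input}
    (hω : ω.jobs = L.map Placed.job) (parallel : Bool) :
    optCost parallel N ω
      ≤ ENNReal.ofReal (L.map fun p => p.fin - p.job.release).sum := by
  refine (iInf₂_le (toSchedule L) (hL.feasible hω parallel)).trans ?_
  have hlen : ω.jobs.length = L.length := by simp [hω]
  have hnn : ∀ p ∈ L, 0 ≤ p.fin - p.job.release := by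
    intro p hp
    have := hL.release_le p hp
    have := p.job.workload_pos
    unfold fin
    linarith
  have h1 : ∀ i : Fin ω.jobs.length,
      (toSchedule L).jobCompletion i ω.jobs[i] - ENNReal.ofReal ω.jobs[i].release
        ≤ ENNReal.ofReal ((L[(i : ℕ)]'(hlen ▸ i.2)).fin - (L[(i : ℕ)]'(hlen ▸ i.2)).job.release) := by
    intro i
    have hi : (i : ℕ) < L.length := hlen ▸ i.2
    have hJ : ω.jobs[i] = L[(i : ℕ)].job := by
      simp [hω]
    rw [hJ, ENNReal.ofReal_sub _ L[(i : ℕ)].job.release_nonneg]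
    exact tsub_le_tsub_right (hL.jobCompletion_le (List.getElem?_eq_getElem hi)) _
  unfold Schedule.cost
  refine (Finset.sum_le_sum fun i _ => h1 i).trans (le_of_eq ?_)
  rw [← ENNReal.ofReal_sum_of_nonneg (fun i _ => hnn _ (List.getElem_mem _))]
  congr 1
  rw [← Fin.sum_univ_fun_getElem]
  exact (Fin.castOrderIso hlen).toEquiv.sum_comp
    (fun i : Fin L.length => L[i].fin - L[i].job.release)

end Placed

end

/-! ### Single-task jobs and round robin blocks -/

noncomputable section

/-- A job with a single task. -/
def Job.single (r s : ℝ) (hr : 0 ≤ r) (hs : 0 < s) (preemptive : Bool) : Job :=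
  ⟨r, hr, [⟨s, hs, preemptive⟩], by simp⟩

section single

variable {r s : ℝ} {hr : 0 ≤ r} {hs : 0 < s} {b : Bool}

@[simp] lemma Job.single_release : (Job.single r s hr hs b).release = r := rfl

@[simp] lemma Job.single_tasks : (Job.single r s hr hs b).tasks = [⟨s, hs, b⟩] := rfl

@[simp] lemma Job.single_workload : (Job.single r s hr hs b).workload = s := by
  simp [Job.workload]

@[simp] lemma Job.single_firstSize : (Job.single r s hr hs b).firstSize = s := rfl

end single

namespace Placed

variable {N : ℕ}

/-- `n` jobs of workload `ℓ`, served from time `s` on in round robin order on `w` machines. -/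
def block {w : ℕ} (hw : 0 < w) (mach : Fin w → Fin N) (s ℓ : ℝ) (n : ℕ) (J : ℕ → Job) :
    List (Placed N) :=
  (List.range n).map fun q => ⟨J q, mach ⟨q % w, Nat.mod_lt _ hw⟩, s + ℓ * (q / w : ℕ)⟩

section block

variable {w : ℕ} {hw : 0 < w} {mach : Fin w → Fin N} {s ℓ : ℝ} {n : ℕ} {J : ℕ → Job}

lemma map_job_block : (block hw mach s ℓ n J).map job = (List.range n).map J := by
  simp [block, Function.comp_def]

lemma mem_block {p : Placed N} (hp : p ∈ block hw mach s ℓ n J) :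
    ∃ q < n, p = ⟨J q, mach ⟨q % w, Nat.mod_lt _ hw⟩, s + ℓ * (q / w : ℕ)⟩ := by
  obtain ⟨q, hq, rfl⟩ := List.mem_map.1 hp
  exact ⟨q, List.mem_range.1 hq, rfl⟩

lemma mach_mem_range_of_mem_block {p : Placed N} (hp : p ∈ block hw mach s ℓ n J) :
    p.mach ∈ Set.range mach := by
  obtain ⟨q, -, rfl⟩ := mem_block hp
  exact ⟨_, rfl⟩

lemma le_start_of_mem_block (hℓ : 0 ≤ ℓ) {p : Placed N} (hp : p ∈ block hw mach s ℓ n J) :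
    s ≤ p.start := by
  obtain ⟨q, -, rfl⟩ := mem_block hp
  exact le_add_of_nonneg_right (by positivity)

lemma fin_le_of_mem_block (hℓ : 0 ≤ ℓ) (hJ : ∀ q, (J q).workload = ℓ) {m : ℕ} (hn : n ≤ w * m)
    {p : Placed N} (hp : p ∈ block hw mach s ℓ n J) : p.fin ≤ s + ℓ * m := by
  obtain ⟨q, hq, rfl⟩ := mem_block hp
  have : q / w + 1 ≤ m := (Nat.div_lt_iff_lt_mul hw).2 (by rw [mul_comm]; exact hq.trans_le hn)
  have h2 : ((q / w : ℕ) : ℝ) + 1 ≤ m := by exact_mod_cast this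
  simp only [fin, hJ]
  nlinarith

lemma pairwise_block (hℓ : 0 ≤ ℓ) (hJ : ∀ q, (J q).workload = ℓ) (hmach : Function.Injective mach) :
    (block hw mach s ℓ n J).Pairwise Compatible := by
  unfold block
  rw [List.pairwise_map]
  refine List.pairwise_lt_range.imp ?_
  intro q q' hqq hm
  left
  have hmod : q % w = q' % w := by simpa using hmach hm
  have hdiv : q / w + 1 ≤ q' / w := by
    have h1 := Nat.div_add_mod q w
    have h2 := Nat.div_add_mod q' w
    by_contra hlt
    have : q' / w ≤ q / w := by omega
    have := Nat.mul_le_mul_left w this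
    omega
  have h2 : ((q / w : ℕ) : ℝ) + 1 ≤ (q' / w : ℕ) := by exact_mod_cast hdiv
  simp only [fin, hJ]
  nlinarith

end block

end Placed

/-! ### The parameters of an instance; inputs with a common prefix -/

namespace Input

variable {ω : Input}

lemma minWorkload_eq (h : ∀ J ∈ ω.jobs, 1 ≤ J.workload) (h1 : ∃ J ∈ ω.jobs, J.workload = 1) :
    ω.minWorkload = 1 := by
  obtain ⟨J, hJ, hJ1⟩ := h1
  obtain ⟨i, hi, rfl⟩ := List.getElem_of_mem hJ
  have : Nonempty (Fin ω.jobs.length) := ⟨⟨i, hi⟩⟩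
  refine le_antisymm ?_ (le_ciInf fun j => h _ (List.getElem_mem _))
  rw [← hJ1]
  exact ciInf_le (f := fun i : Fin ω.jobs.length => ω.jobs[i].workload)
    (Set.finite_range _).bddBelow ⟨i, hi⟩

lemma alpha_eq {a : ℝ} (h : ∀ J ∈ ω.jobs, 1 ≤ J.workload) (h1 : ∃ J ∈ ω.jobs, J.workload = 1)
    (h' : ∀ J ∈ ω.jobs, J.workload ≤ a) (ha : ∃ J ∈ ω.jobs, J.workload = a) : ω.alpha = a := by
  unfold alpha
  rw [minWorkload_eq h h1, div_one]
  obtain ⟨J, hJ, hJ1⟩ := ha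
  obtain ⟨i, hi, rfl⟩ := List.getElem_of_mem hJ
  have : Nonempty (Fin ω.jobs.length) := ⟨⟨i, hi⟩⟩
  refine le_antisymm (ciSup_le fun j => h' _ (List.getElem_mem _)) ?_
  conv_lhs => rw [← hJ1]
  exact le_ciSup (f := fun i : Fin ω.jobs.length => ω.jobs[i].workload)
    (Set.finite_range _).bddAbove ⟨i, hi⟩

lemma beta_eq {b : ℝ} (hb : 0 ≤ b) (h : ∀ J ∈ ω.jobs, 1 ≤ J.workload)
    (h1 : ∃ J ∈ ω.jobs, J.workload = 1)
    (hle : ∀ J ∈ ω.jobs, ∀ τ ∈ J.tasks, τ.preemptive = false → τ.size ≤ b)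
    (hmem : 0 < b → ∃ J ∈ ω.jobs, ∃ τ ∈ J.tasks, τ.preemptive = false ∧ b = τ.size) :
    ω.beta = b := by
  unfold beta
  rw [minWorkload_eq h h1, div_one]
  unfold eta
  -- For b = 0 no task is non-preemptive, because sizes are positive, and the real supremum of the
  -- empty set is 0.
  rcases hb.eq_or_lt with rfl | hb
  · convert Real.sSup_empty
    ext x
    simp only [Set.mem_ofPred_eq, Set.mem_empty_iff_false, iff_false]
    rintro ⟨J, hJ, τ, hτ, hp, -⟩
    linarith [hle J hJ τ hτ hp, τ.size_pos]
  · refine IsGreatest.csSup_eq ⟨hmem hb, ?_⟩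
    rintro x ⟨J, hJ, τ, hτ, hp, rfl⟩
    exact hle J hJ τ hτ hp

/-- Two instances that differ only in jobs released at time `T` or later agree before `T`. -/
lemma agreeUpTo_of_append {ω ω' : Input} {P X Y : List Job} {T t : ℝ} (h : ω.jobs = P ++ X)
    (h' : ω'.jobs = P ++ Y) (hX : ∀ J ∈ X, T ≤ J.release) (hY : ∀ J ∈ Y, T ≤ J.release)
    (ht : t < T) : ω.AgreeUpTo ω' t := by
  intro i J hJ
  rw [h, h']
  rcases lt_or_ge i P.length with hi | hi
  · rw [List.getElem?_append_left hi, List.getElem?_append_left hi]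
  · rw [List.getElem?_append_right hi, List.getElem?_append_right hi]
    constructor <;> intro hm
    · linarith [hX J (List.mem_of_getElem? hm)]
    · linarith [hY J (List.mem_of_getElem? hm)]

end Input

/-- Service before T depends on the schedule at times strictly below T only, so the inputs may
already differ in jobs released exactly at T. -/
lemma OnlineAlgorithm.served_eq_of_append {parallel : Bool} {N : ℕ}
    (A : OnlineAlgorithm parallel N) {ω ω' : Input} {P X Y : List Job} {T : ℝ}
    (h : ω.jobs = P ++ X) (h' : ω'.jobs = P ++ Y) (hX : ∀ J ∈ X, T ≤ J.release)
    (hY : ∀ J ∈ Y, T ≤ J.release) (k : ℕ × ℕ) :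
    (A.run ω).served k T = (A.run ω').served k T :=
  Schedule.served_congr (fun u hu => A.nonanticipating ω ω' u
    (Input.agreeUpTo_of_append h h' hX hY hu) u le_rfl) k

lemma OnlineAlgorithm.residual_eq_of_append {parallel : Bool} {N : ℕ}
    (A : OnlineAlgorithm parallel N) {ω ω' : Input} {P X Y : List Job} {T : ℝ}
    (h : ω.jobs = P ++ X) (h' : ω'.jobs = P ++ Y) (hX : ∀ J ∈ X, T ≤ J.release)
    (hY : ∀ J ∈ Y, T ≤ J.release) {i : ℕ} (hi : i < P.length) :
    ω.residual (A.run ω) i T = ω'.residual (A.run ω') i T := by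
  unfold Input.residual
  rw [A.served_eq_of_append h h' hX hY, h, h', List.getElem?_append_left hi,
    List.getElem?_append_left hi]

/-! ### From capped backlog to response time -/

namespace Schedule

variable {N : ℕ} {S : Schedule N} {ω : Input}

lemma sub_sum_served_le_sum_cap (I : Finset ℕ) (c : ℝ) {s t : ℝ} (hs : 0 ≤ s) (hst : s ≤ t) :
    ∑ i ∈ I, cap c (ω.residual S i s) - ∑ i ∈ I, (S.served (i, 0) t - S.served (i, 0) s)
      ≤ ∑ i ∈ I, cap c (ω.residual S i t) := by
  rw [← Finset.sum_sub_distrib]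
  refine Finset.sum_le_sum fun i _ => ?_
  refine (cap_sub_le (sub_nonneg.2 (served_mono _ hs hst)) _ _).trans (le_of_eq ?_)
  unfold Input.residual
  congr 1; ring

lemma Feasible.sub_le_sum_cap {parallel : Bool} (hS : S.Feasible parallel ω) (I : Finset ℕ)
    (c : ℝ) {s t : ℝ} (hs : 0 ≤ s) (hst : s ≤ t) :
    ∑ i ∈ I, cap c (ω.residual S i s) - N * (t - s) ≤ ∑ i ∈ I, cap c (ω.residual S i t) := by
  linarith [hS.sum_served_sub_le I hs hst, sub_sum_served_le_sum_cap (S := S) (ω := ω) I c hs hst]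

/-- If, at each of `M` consecutive unit steps, the capped residuals of the released jobs add up to
at least `θ`, then the total response time is at least `θ * M`. -/
lemma ofReal_mul_le_cost {T θ : ℝ} {M : ℕ} {n : ℕ → ℕ}
    (hn : ∀ j < M, n j ≤ ω.jobs.length)
    (hrel : ∀ j < M, ∀ i (hi : i < ω.jobs.length), i < n j → (ω.jobs[i]).release ≤ T + j)
    (h : ∀ j < M, θ ≤ ∑ i ∈ Finset.range (n j), cap 1 (ω.residual S i (T + j + 1))) :
    ENNReal.ofReal (θ * M) ≤ S.cost ω := by
  classical
  -- `B i` collects the steps j at whose end job i, released by T + j, is unfinished. The job is in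
  -- the system from the first such step to the end of the last, so the size of `B i` is at most its
  -- response time. Counting by steps instead gives at least θ each, as a capped residual is at most
  -- 1.
  set B : ℕ → Finset ℕ := fun i =>
    (Finset.range M).filter fun j => i < n j ∧ 0 < ω.residual S i (T + j + 1) with hB
  have h1 : ∀ i : Fin ω.jobs.length, ENNReal.ofReal ((B i).card : ℝ)
      ≤ S.jobCompletion i ω.jobs[i] - ENNReal.ofReal ω.jobs[i].release := by
    intro i
    rcases (B i).eq_empty_or_nonempty with h0 | h0
    · simp [h0]
    · have hmin := Finset.min'_mem _ h0
      have hmax := Finset.max'_mem _ h0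
      set j₀ := (B i).min' h0
      set j₁ := (B i).max' h0
      have hsub : B i ⊆ Finset.Icc j₀ j₁ := fun j hj =>
        Finset.mem_Icc.2 ⟨Finset.min'_le _ _ hj, Finset.le_max' _ _ hj⟩
      have hcard := Finset.card_le_card hsub
      have hle : j₀ ≤ j₁ := Finset.min'_le _ _ hmax
      rw [Nat.card_Icc] at hcard
      have hcard' : ((B i).card : ℝ) ≤ j₁ + 1 - j₀ := by
        rw [le_sub_iff_add_le]
        exact_mod_cast (by omega : (B i).card + j₀ ≤ j₁ + 1)
      simp only [hB, Finset.mem_filter, Finset.mem_range] at hmin hmax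
      have hr := hrel j₀ hmin.1 i i.2 hmin.2.1
      have hres := hmax.2.2
      have hc : ENNReal.ofReal (T + j₁ + 1) ≤ S.jobCompletion i ω.jobs[i] := by
        refine le_jobCompletion ?_
        simpa [Input.residual] using hres
      calc ENNReal.ofReal ((B i).card : ℝ)
          ≤ ENNReal.ofReal (T + j₁ + 1 - ω.jobs[i].release) :=
            ENNReal.ofReal_le_ofReal (by simp only [Fin.getElem_fin]; linarith)
        _ = ENNReal.ofReal (T + j₁ + 1) - ENNReal.ofReal ω.jobs[i].release :=
            ENNReal.ofReal_sub _ ω.jobs[i].release_nonneg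
        _ ≤ _ := tsub_le_tsub_right hc _
  unfold cost
  refine le_trans ?_ (Finset.sum_le_sum fun i _ => h1 i)
  rw [← ENNReal.ofReal_sum_of_nonneg (fun i _ => Nat.cast_nonneg _),
    ← Finset.sum_range (fun i => ((B i).card : ℝ))]
  refine ENNReal.ofReal_le_ofReal ?_
  have h2 : ∀ i, ((B i).card : ℝ) = ∑ j ∈ Finset.range M,
      if i < n j ∧ 0 < ω.residual S i (T + j + 1) then (1 : ℝ) else 0 := by
    intro i
    simp [hB, Finset.sum_boole]
  simp only [h2]
  rw [Finset.sum_comm]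
  have h3 : ∀ j ∈ Finset.range M, θ ≤ ∑ i ∈ Finset.range ω.jobs.length,
      if i < n j ∧ 0 < ω.residual S i (T + j + 1) then (1 : ℝ) else 0 := by
    intro j hj
    have hj := Finset.mem_range.1 hj
    refine (h j hj).trans ?_
    refine le_trans ?_ (Finset.sum_le_sum_of_subset_of_nonneg
      (Finset.range_subset_range.2 (hn j hj)) fun i _ _ => by split_ifs <;> norm_num)
    refine Finset.sum_le_sum fun i hi => ?_
    split_ifs with hc
    · exact cap_le zero_le_one _
    · rw [cap_eq_zero]
      by_contra hlt
      exact hc ⟨Finset.mem_range.1 hi, not_le.1 hlt⟩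
  have h4 := Finset.sum_le_sum h3
  rw [Finset.sum_const, Finset.card_range, nsmul_eq_mul] at h4
  linarith

end Schedule

end

/-! ### The backlog principle -/

noncomputable section

/-- A list of tasks of total size `a` whose non-preemptive tasks have maximal size `b`. -/
lemma exists_tasks {a b : ℝ} (ha : 1 ≤ a) (hb : 0 ≤ b) (hba : b ≤ a) :
    ∃ l : List Task, l ≠ [] ∧ (l.map Task.size).sum = a ∧
      (∀ τ ∈ l, τ.preemptive = false → τ.size ≤ b) ∧
      (0 < b → ∃ τ ∈ l, τ.preemptive = false ∧ b = τ.size) := by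
  have ha0 : 0 < a := by linarith
  rcases hb.eq_or_lt with rfl | hb
  · exact ⟨[⟨a, ha0, true⟩], by simp, by simp, by simp, by simp⟩
  · rcases hba.eq_or_lt with rfl | hba
    · exact ⟨[⟨b, ha0, false⟩], by simp, by simp, by simp, by simp⟩
    · exact ⟨[⟨b, hb, false⟩, ⟨a - b, by linarith, true⟩], by simp, by simp, by simp, by simp⟩

lemma ofReal_le_div_of_le {x y : ℝ} {X Y : ℝ≥0∞} {θ : ℝ} (hy : 0 < y) (hxy : θ * y ≤ x)
    (hX : ENNReal.ofReal x ≤ X) (hY : Y ≤ ENNReal.ofReal y) : ENNReal.ofReal θ ≤ X / Y := by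
  calc ENNReal.ofReal θ ≤ ENNReal.ofReal (x / y) :=
        ENNReal.ofReal_le_ofReal ((le_div_iff₀ hy).2 hxy)
    _ = ENNReal.ofReal x / ENNReal.ofReal y := ENNReal.ofReal_div_of_pos hy
    _ ≤ X / Y := ENNReal.div_le_div hX hY

/-- The unit jobs released `N` at a time at unit distances from time `T` on. -/
def streamJob (N : ℕ) (T : ℝ) (hT : 0 ≤ T) (q : ℕ) : Job :=
  Job.single (T + (q / N : ℕ)) 1 (by positivity) one_pos true

open Placed in
/-- Suppose that jobs `base` released by time `T` can be scheduled such that all are completed by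
time `T`, except for a few which are started at a later time `t` only. If the algorithm leaves at
least `θ * N` units of (capped) work on these jobs at time `T`, then a long stream of unit jobs
released after time `T` shows that its competitive ratio is at least `θ / 3`. -/
lemma exists_input_of_backlog {parallel : Bool} {N : ℕ} (hN : 0 < N)
    (A : OnlineAlgorithm parallel N) {a b : ℝ} (ha : 1 ≤ a) (hb : 0 ≤ b) (hba : b ≤ a)
    {base : List Job} {T : ℝ} (hT : 0 ≤ T)
    (hsorted : base.Pairwise fun J K => J.release ≤ K.release)
    (hrel : ∀ J ∈ base, J.release ≤ T)
    (hw : ∀ J ∈ base, 1 ≤ J.workload ∧ J.workload ≤ a)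
    (hnp : ∀ J ∈ base, ∀ τ ∈ J.tasks, τ.preemptive = false → τ.size ≤ b)
    {C : ℝ} (hC : 0 ≤ C)
    (hplace : ∀ t, T ≤ t → ∃ L : List (Placed N), L.map job = base ∧ Valid L ∧
      (∀ p ∈ L, p.fin ≤ T ∨ t ≤ p.start) ∧ (∀ p ∈ L, p.fin ≤ t + C) ∧
      (L.map fun p => p.fin - p.job.release).sum ≤ C + N * t)
    (θ : ℝ) :
    ∃ ω : Input, ω.alpha = a ∧ ω.beta = b ∧
      (∃ X, ω.jobs = base ++ X ∧ ∀ J ∈ X, T ≤ J.release) ∧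
      (θ * N ≤ ∑ i ∈ Finset.range base.length, cap 1 (ω.residual (A.run ω) i T) →
        ENNReal.ofReal (θ / 3) ≤
          A.competitiveRatio {ω : Input | ω.alpha = a ∧ ω.beta = b}) := by
  have hN1 : (1 : ℝ) ≤ N := by exact_mod_cast hN
  obtain ⟨tasks, hne, hsum, htnp, htmem⟩ := exists_tasks ha hb hba
  -- A stream this long makes the fixed costs at most N M. The stream costs N M and the postponed
  -- jobs another N M, whence the factor 3.
  obtain ⟨M, hM⟩ := exists_nat_ge (C + N * T + a)
  have hM1 : (1 : ℝ) ≤ M := by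
    have : 0 ≤ (N : ℝ) * T := by positivity
    linarith
  have hM0 : 0 < M := by exact_mod_cast (zero_lt_one.trans_le hM1)
  -- This job realises α = a and β = b whatever the base jobs are. It arrives when everything else
  -- is finished offline, so it adds only a to the offline cost.
  set last : Job := ⟨T + M + C, by positivity, tasks, hne⟩ with hlast
  have hlastw : last.workload = a := hsum
  set stream : List Job := (List.range (N * M)).map (streamJob N T hT) with hstream
  have hstream_mem : ∀ J ∈ stream, ∃ q < N * M, J = streamJob N T hT q := by
    intro J hJ
    obtain ⟨q, hq, rfl⟩ := List.mem_map.1 hJ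
    exact ⟨q, List.mem_range.1 hq, rfl⟩
  have hTstream : ∀ J ∈ stream, T ≤ J.release ∧ J.release ≤ T + M := by
    intro J hJ
    obtain ⟨q, hq, rfl⟩ := hstream_mem J hJ
    have : q / N ≤ M := (Nat.div_lt_of_lt_mul hq).le
    have h2 : ((q / N : ℕ) : ℝ) ≤ M := by exact_mod_cast this
    simp only [streamJob, Job.single_release]
    exact ⟨le_add_of_nonneg_right (by positivity), by linarith⟩
  have hX : ∀ J ∈ stream ++ [last], T ≤ J.release := by
    intro J hJ
    rcases List.mem_append.1 hJ with hJ | hJ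
    · exact (hTstream J hJ).1
    · rw [List.mem_singleton.1 hJ]
      simp only [hlast]
      linarith
  have hstream_sorted : stream.Pairwise fun J K => J.release ≤ K.release := by
    rw [hstream, List.pairwise_map]
    refine List.pairwise_lt_range.imp fun {q q'} h => ?_
    have h2 : ((q / N : ℕ) : ℝ) ≤ (q' / N : ℕ) := by exact_mod_cast Nat.div_le_div_right h.le
    simpa [streamJob] using h2
  set ω : Input := ⟨base ++ (stream ++ [last]), by simp, by
    rw [List.pairwise_append, List.pairwise_append]
    refine ⟨hsorted, ⟨hstream_sorted, by simp, ?_⟩, fun J hJ K hK => (hrel J hJ).trans (hX K hK)⟩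
    intro J hJ K hK
    rw [List.mem_singleton.1 hK]
    simp only [hlast]
    linarith [(hTstream J hJ).2]⟩ with hω
  have hjobs : ω.jobs = base ++ (stream ++ [last]) := rfl
  have hwork : ∀ J ∈ ω.jobs, 1 ≤ J.workload ∧ J.workload ≤ a := by
    intro J hJ
    rw [hjobs, List.mem_append, List.mem_append] at hJ
    rcases hJ with hJ | hJ | hJ
    · exact hw J hJ
    · obtain ⟨q, -, rfl⟩ := hstream_mem J hJ
      simp [streamJob, ha]
    · rw [List.mem_singleton.1 hJ, hlastw]
      exact ⟨ha, le_rfl⟩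
  have hone : ∃ J ∈ ω.jobs, J.workload = 1 := by
    refine ⟨streamJob N T hT 0, ?_, by simp [streamJob]⟩
    rw [hjobs, List.mem_append, List.mem_append]
    exact Or.inr (Or.inl (List.mem_map.2 ⟨0, List.mem_range.2 (by positivity), rfl⟩))
  have hlast_mem : last ∈ ω.jobs := by simp [hjobs]
  have halpha : ω.alpha = a := Input.alpha_eq (fun J hJ => (hwork J hJ).1) hone
    (fun J hJ => (hwork J hJ).2) ⟨last, hlast_mem, hlastw⟩
  have hbeta : ω.beta = b := by
    refine Input.beta_eq hb (fun J hJ => (hwork J hJ).1) hone ?_ ?_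
    · intro J hJ
      rw [hjobs, List.mem_append, List.mem_append] at hJ
      rcases hJ with hJ | hJ | hJ
      · exact hnp J hJ
      · obtain ⟨q, -, rfl⟩ := hstream_mem J hJ
        simp [streamJob]
      · rw [List.mem_singleton.1 hJ]
        exact htnp
    · exact fun h => ⟨last, hlast_mem, htmem h⟩
  refine ⟨ω, halpha, hbeta, ⟨_, hjobs, hX⟩, fun hback => ?_⟩
  have hNM : (0 : ℝ) < N * M := by positivity
  -- the cost of the optimal schedule
  have hopt : optCost parallel N ω ≤ ENNReal.ofReal (3 * (N * M)) := by
    -- With t = T + M the postponed base jobs run after the stream, and by T + M + C they are done.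
    obtain ⟨L, hLjob, hLv, hL1, hL2, hLcost⟩ := hplace (T + M) (by linarith)
    set Ls : List (Placed N) := block hN id T 1 (N * M) (streamJob N T hT) with hLs
    set pl : Placed N := ⟨last, ⟨0, hN⟩, T + M + C⟩ with hpl
    have hsw : ∀ q, (streamJob N T hT q).workload = 1 := fun q => by simp [streamJob]
    have hLs1 : ∀ p ∈ Ls, p.fin ≤ T + M := fun p hp => by
      simpa using fin_le_of_mem_block zero_le_one hsw le_rfl hp
    have hLs2 : ∀ p ∈ Ls, T ≤ p.start := fun p hp => le_start_of_mem_block zero_le_one hp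
    have hv : Valid (L ++ (Ls ++ [pl])) := by
      constructor
      · intro p hp
        rw [List.mem_append, List.mem_append] at hp
        rcases hp with hp | hp | hp
        · exact hLv.release_le p hp
        · obtain ⟨q, -, rfl⟩ := mem_block hp
          simp [streamJob]
        · rw [List.mem_singleton.1 hp]
      · rw [List.pairwise_append, List.pairwise_append]
        refine ⟨hLv.compatible, ⟨pairwise_block zero_le_one hsw Function.injective_id, by simp, ?_⟩,
          ?_⟩
        · intro p hp q hq _
          left
          rw [List.mem_singleton.1 hq]
          simp only [hpl]
          linarith [hLs1 p hp]
        · intro p hp q hq _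
          rcases List.mem_append.1 hq with hq | hq
          · rcases hL1 p hp with h | h
            · exact Or.inl (h.trans (hLs2 q hq))
            · exact Or.inr ((hLs1 q hq).trans h)
          · left
            rw [List.mem_singleton.1 hq]
            exact hL2 p hp
    have hmap : ω.jobs = (L ++ (Ls ++ [pl])).map job := by
      rw [List.map_append, List.map_append, hLjob, hLs, map_job_block, hjobs]
      rfl
    refine (hv.optCost_le hmap parallel).trans (ENNReal.ofReal_le_ofReal ?_)
    have hLssum : (Ls.map fun p => p.fin - p.job.release).sum = N * M := by
      have : (Ls.map fun p => p.fin - p.job.release) = List.replicate (N * M) (1 : ℝ) := by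
        rw [List.eq_replicate_iff]
        refine ⟨by simp [hLs, block], fun x hx => ?_⟩
        obtain ⟨p, hp, rfl⟩ := List.mem_map.1 hx
        obtain ⟨q, -, rfl⟩ := mem_block hp
        simp [fin, streamJob]
      rw [this]; simp
    have hplc : pl.fin - pl.job.release = a := by
      change T + M + C + last.workload - (T + M + C) = a
      rw [hlastw]
      ring
    rw [List.map_append, List.map_append, List.sum_append, List.sum_append, hLssum,
      List.map_singleton, List.sum_singleton, hplc]
    have : (M : ℝ) ≤ N * M := by nlinarith
    linarith
  -- the cost of the algorithm
  have hcost : ENNReal.ofReal (θ * N * M) ≤ (A.run ω).cost ω := by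
    have hlen : ω.jobs.length = base.length + (N * M + 1) := by simp [hjobs, hstream]
    have hnb : ∀ j < M, N * (j + 1) ≤ N * M := fun j hj => Nat.mul_le_mul_left _ hj
    have hget : ∀ q < N * M, ω.jobs[base.length + q]? = some (streamJob N T hT q) := by
      intro q hq
      rw [hjobs, List.getElem?_append_right (by omega), Nat.add_sub_cancel_left,
        List.getElem?_append_left (by simpa [hstream] using hq)]
      simp [hstream, hq]
    refine Schedule.ofReal_mul_le_cost (T := T) (n := fun j => base.length + N * (j + 1)) ?_ ?_ ?_
    · intro j hj
      have := hnb j hj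
      omega
    · intro j hj i hi hin
      rcases lt_or_ge i base.length with hib | hib
      · have : ω.jobs[i] = base[i] := by simp [hjobs, List.getElem_append_left hib]
        rw [this]
        have := hrel _ (List.getElem_mem hib)
        have : (0 : ℝ) ≤ j := by positivity
        linarith
      · obtain ⟨q, rfl⟩ := Nat.exists_eq_add_of_le hib
        have hq : q < N * (j + 1) := by omega
        have hJ := hget q (hq.trans_le (hnb j hj))
        have : ω.jobs[base.length + q] = streamJob N T hT q := by
          rw [List.getElem?_eq_getElem hi] at hJ
          simpa using hJ
        rw [this]
        have : q / N ≤ j := Nat.lt_succ_iff.1 (Nat.div_lt_of_lt_mul hq)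
        have h2 : ((q / N : ℕ) : ℝ) ≤ j := by exact_mod_cast this
        simp only [streamJob, Job.single_release]
        linarith
    · intro j hj
      -- The N (j + 1) unit jobs released since T offset the at most N (j + 1) units of service, so
      -- the backlog of the base jobs at T survives in the sum.
      have hstep := (A.feasible ω).sub_le_sum_cap
        (Finset.range (base.length + N * (j + 1))) 1 hT (by linarith [Nat.cast_nonneg (α := ℝ) j] :
          T ≤ T + j + 1)
      refine le_trans ?_ hstep
      rw [Finset.sum_range_add]
      have hnew : ∑ q ∈ Finset.range (N * (j + 1)),
          cap 1 (ω.residual (A.run ω) (base.length + q) T) = N * (j + 1) := by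
        rw [Finset.sum_congr rfl (g := fun _ => (1 : ℝ))]
        · simp
        · intro q hq
          have hJ := hget q ((Finset.mem_range.1 hq).trans_le (hnb j hj))
          have h0 := (A.feasible ω).served_eq_zero_of_le_release (l := 0) hJ
            (t := T) (by simp [streamJob])
          simp [Input.residual, hJ, h0, streamJob, cap]
      rw [hnew]
      linarith
  have hmain := ofReal_le_div_of_le (θ := θ / 3) (y := 3 * (N * M)) (by positivity)
    (by linarith) hcost hopt
  exact hmain.trans (le_iSup₂ (f := fun (ω : Input) (_ : ω ∈ {ω : Input | ω.alpha = a ∧ ω.beta = b}) =>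
    (A.run ω).cost ω / optCost parallel N ω) ω ⟨halpha, hbeta⟩)

end

/-! ### The constant bound and the bound linear in b -/

noncomputable section

namespace Placed

variable {N : ℕ}

lemma sum_fin_sub_release_le {L : List (Placed N)} {x : ℝ} (h : ∀ p ∈ L, p.fin ≤ x) :
    (L.map fun p => p.fin - p.job.release).sum ≤ L.length * x := by
  have := List.sum_le_card_nsmul (L.map fun p => p.fin - p.job.release) x (by
    intro y hy
    obtain ⟨p, hp, rfl⟩ := List.mem_map.1 hy
    linarith [h p hp, p.job.release_nonneg])
  simpa using this

lemma length_block {w : ℕ} {hw : 0 < w} {mach : Fin w → Fin N} {s ℓ : ℝ} {n : ℕ} {J : ℕ → Job} :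
    (block hw mach s ℓ n J).length = n := by simp [block]

/-- A block of identical jobs that starts at their releasing date or later is valid. -/
lemma valid_block_const {w : ℕ} {hw : 0 < w} {mach : Fin w → Fin N} {s : ℝ} {n : ℕ} {J : Job}
    (hs : J.release ≤ s) (hmach : Function.Injective mach) :
    Valid (block hw mach s J.workload n fun _ => J) := by
  refine ⟨fun p hp => ?_, pairwise_block J.workload_pos.le (fun _ => rfl) hmach⟩
  refine le_trans ?_ (le_start_of_mem_block J.workload_pos.le hp)
  obtain ⟨q, -, rfl⟩ := mem_block hp
  exact hs

lemma Valid.append {L L' : List (Placed N)} (h : Valid L) (h' : Valid L')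
    (hLL : ∀ p ∈ L, ∀ q ∈ L', p.Compatible q) : Valid (L ++ L') := by
  refine ⟨fun p hp => ?_, List.pairwise_append.2 ⟨h.compatible, h'.compatible, hLL⟩⟩
  rcases List.mem_append.1 hp with hp | hp
  · exact h.release_le p hp
  · exact h'.release_le p hp

end Placed

/-- `n` copies of a job. -/
abbrev copies (n : ℕ) (J : Job) : List Job := (List.range n).map fun _ => J

lemma eq_of_mem_copies {n : ℕ} {J K : Job} (h : K ∈ copies n J) : K = J := by
  obtain ⟨q, -, rfl⟩ := List.mem_map.1 h
  rfl

lemma pairwise_copies (n : ℕ) (J : Job) :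
    (copies n J).Pairwise fun J K => J.release ≤ K.release :=
  List.pairwise_map.2 (List.pairwise_lt_range.imp fun _ => le_rfl)

variable {parallel : Bool} {N : ℕ} {a b : ℝ}

open Placed in
-- The backlog principle with T = 0: N unit jobs released at time 0 are all untouched then, so θ =
-- 1.
lemma OnlineAlgorithm.one_third_le_competitiveRatio (hN : 0 < N) (A : OnlineAlgorithm parallel N)
    (ha : 1 ≤ a) (hb : 0 ≤ b) (hba : b ≤ a) :
    ENNReal.ofReal (1 / 3) ≤ A.competitiveRatio {ω : Input | ω.alpha = a ∧ ω.beta = b} := by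
  have hN1 : (1 : ℝ) ≤ N := by exact_mod_cast hN
  set J : Job := Job.single 0 1 le_rfl one_pos true with hJ
  obtain ⟨ω, -, -, ⟨X, hX, -⟩, h⟩ := exists_input_of_backlog hN A ha hb hba (base := copies N J)
    (T := 0) le_rfl (pairwise_copies N J)
    (fun K hK => by rw [eq_of_mem_copies hK]; exact le_rfl)
    (fun K hK => by rw [eq_of_mem_copies hK]; simp [hJ, ha])
    (fun K hK => by rw [eq_of_mem_copies hK]; simp [hJ])
    (C := N) (by positivity)
    (by
      intro t ht
      have hfin : ∀ p ∈ block hN id t J.workload N fun _ => J, p.fin ≤ t + 1 := fun p hp => by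
        simpa [hJ] using fin_le_of_mem_block (m := 1) J.workload_pos.le (fun _ => rfl) (by simp) hp
      refine ⟨block hN id t J.workload N fun _ => J, map_job_block,
        valid_block_const ht Function.injective_id,
        fun p hp => Or.inr (le_start_of_mem_block J.workload_pos.le hp),
        fun p hp => (hfin p hp).trans (by linarith), ?_⟩
      have := sum_fin_sub_release_le hfin
      rw [length_block] at this
      linarith)
    1
  refine h ?_
  have hval : ∀ i ∈ Finset.range (copies N J).length, cap 1 (ω.residual (A.run ω) i 0) = 1 := by
    intro i hi
    have hi : i < N := by simpa using hi
    have hget : ω.jobs[i]? = some J := by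
      rw [hX, List.getElem?_append_left (by simpa using hi)]
      simp [hi]
    have h0 := (A.feasible ω).served_eq_zero_of_le_release (l := 0) hget (t := 0) le_rfl
    simp [Input.residual, hget, h0, hJ, cap]
  rw [Finset.sum_congr rfl hval]
  simp

/-- If `N` jobs with a single non-preemptive task of length `b` are the only ones released at time
`0`, then a work-conserving algorithm serves no other job before time `b`. -/
lemma OnlineAlgorithm.WorkConserving.run_ne_some {A : OnlineAlgorithm parallel N}
    (hA : A.WorkConserving) {ω : Input} {s : ℝ} (hs : 0 < s) {X : List Job}
    (hω : ω.jobs = copies N (Job.single 0 s le_rfl hs false) ++ X)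
    (hX : ∀ J ∈ X, 0 < J.release) {u : ℝ} (hu : u < s) (m : Fin N) {i l : ℕ} (hi : N ≤ i) :
    A.run ω u m ≠ some (i, l) := by
  intro hrun
  set S := A.run ω with hS
  have hF := A.feasible ω
  have hget : ∀ j < N, ω.jobs[j]? = some (Job.single 0 s le_rfl hs false) := by
    intro j hj
    rw [hω, List.getElem?_append_left (by simpa using hj)]
    simp [hj]
  -- If a machine were idle at time 0, work conservation would put each of the N jobs in service.
  -- Distinct jobs need distinct machines, so no machine would be idle.
  have hnone : ∀ m', S 0 m' ≠ none := by
    intro m' hm'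
    have hidle := hA ω 0 m' hm'
    have hserved : ∀ j : Fin N, ∃ m'' l', S 0 m'' = some ((j : ℕ), l') := by
      intro j
      by_contra hcon
      push Not at hcon
      refine hidle ⟨(j, 0), ⟨_, _, Job.isTask_zero (hget j j.2), le_rfl, ?_⟩,
        fun m'' => hcon m'' 0, fun _ => hcon⟩
      have h0 := hF.served_eq_zero_of_le_release (l := 0) (hget j j.2) (t := 0) le_rfl
      rw [h0]
      exact Task.size_pos _
    choose f l' hf using hserved
    have hinj : Function.Injective f := by
      intro j j' hjj
      have := (hf j).symm.trans (hjj ▸ hf j')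
      simp only [Option.some_inj, Prod.mk.injEq] at this
      exact Fin.ext this.1
    obtain ⟨j, hj⟩ := (Finite.injective_iff_surjective.1 hinj) m'
    have := hf j
    rw [hj, hm'] at this
    cases this
  have hu0 : 0 ≤ u := by
    obtain ⟨J, τ, -, hr, -⟩ := hF.alive u m _ hrun
    exact J.release_nonneg.trans hr
  obtain ⟨⟨j, l₀⟩, hk⟩ := Option.ne_none_iff_exists'.1 (hnone m)
  obtain ⟨J, τ, hkJ, hr, -⟩ := hF.alive 0 m _ hk
  have hj : j < N := by
    by_contra hge
    have h1 := hkJ.1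
    simp only at h1
    rw [hω, List.getElem?_append_right (by simpa using hge)] at h1
    linarith [hX J (List.mem_of_getElem? h1)]
  have hJ : Job.single 0 s le_rfl hs false = J := by simpa using (hget j hj).symm.trans hkJ.1
  subst hJ
  have hτmem : τ ∈ (Job.single 0 s le_rfl hs false).tasks := List.mem_of_getElem? hkJ.2
  have hτ : τ = ⟨s, hs, false⟩ := by simpa using hτmem
  -- The service interval of this task contains 0 and cannot start earlier, so it is [0, s).
  obtain ⟨s₀, m₀, hint⟩ := hF.nonpreemptive _ _ _ hkJ (by rw [hτ]) ⟨0, m, hk⟩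
  obtain ⟨hm₀, hs₀, -⟩ := (hint 0 m).1 hk
  have hstart : S s₀ m₀ = some (j, l₀) := (hint s₀ m₀).2 ⟨rfl, le_rfl, by linarith [τ.size_pos]⟩
  obtain ⟨J', τ', -, hr', -⟩ := hF.alive s₀ m₀ _ hstart
  have hs₀' : 0 ≤ s₀ := J'.release_nonneg.trans hr'
  have hum : S u m = some (j, l₀) := (hint u m).2 ⟨hm₀, by linarith, by rw [hτ]; simp only; linarith⟩
  rw [hrun] at hum
  simp only [Option.some_inj, Prod.mk.injEq] at hum
  omega

open Placed in
-- The long jobs occupy every machine until b, so the N B unit jobs released at b - B are untouched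
-- at time b. Offline, they fill all machines during [b - B, b] and the long jobs are postponed.
-- Thus θ = B ≥ b - 1 ≥ b / 2 when b > 2; smaller b are covered by the bound 1/3.
lemma OnlineAlgorithm.WorkConserving.div_six_le_competitiveRatio (hN : 0 < N)
    {A : OnlineAlgorithm parallel N} (hA : A.WorkConserving) (ha : 1 ≤ a) (hb : 0 ≤ b)
    (hba : b ≤ a) :
    ENNReal.ofReal (b / 6) ≤ A.competitiveRatio {ω : Input | ω.alpha = a ∧ ω.beta = b} := by
  rcases le_or_gt b 2 with hb2 | hb2
  · exact (ENNReal.ofReal_le_ofReal (by linarith)).trans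
      (A.one_third_le_competitiveRatio hN ha hb hba)
  -- The inequality B < b is strict so that the unit jobs arrive after time 0, when all machines are
  -- already taken.
  obtain ⟨B, hB1, hB2⟩ : ∃ B : ℕ, (B : ℝ) < b ∧ b ≤ B + 1 := by
    refine ⟨⌈b⌉₊ - 1, ?_, ?_⟩
    · have h1 : 1 ≤ ⌈b⌉₊ := Nat.one_le_ceil_iff.2 (by linarith)
      rw [Nat.cast_sub h1]
      have := Nat.ceil_lt_add_one hb
      push_cast
      linarith
    · have h1 : 1 ≤ ⌈b⌉₊ := Nat.one_le_ceil_iff.2 (by linarith)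
      rw [Nat.cast_sub h1]
      have := Nat.le_ceil b
      push_cast
      linarith
  have hN1 : (1 : ℝ) ≤ N := by exact_mod_cast hN
  have hb0 : 0 < b := by linarith
  set J : Job := Job.single 0 b le_rfl hb0 false with hJ
  set U : Job := Job.single (b - B) 1 (by linarith) one_pos true with hU
  have hmem : ∀ K ∈ copies N J ++ copies (N * B) U, K = J ∨ K = U := fun K hK =>
    (List.mem_append.1 hK).imp eq_of_mem_copies eq_of_mem_copies
  obtain ⟨ω, -, -, ⟨X, hX, hXrel⟩, h⟩ := exists_input_of_backlog hN A ha hb hba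
    (base := copies N J ++ copies (N * B) U) (T := b) hb
    (List.pairwise_append.2 ⟨pairwise_copies _ _, pairwise_copies _ _, fun K hK K' hK' => by
      rw [eq_of_mem_copies hK, eq_of_mem_copies hK']
      simp only [hJ, hU, Job.single_release]
      linarith⟩)
    (fun K hK => by rcases hmem K hK with rfl | rfl <;> simp [hJ, hU, hb])
    (fun K hK => by
      rcases hmem K hK with rfl | rfl
      · simp only [hJ, Job.single_workload]; exact ⟨by linarith, hba⟩
      · simp [hU, ha])
    (fun K hK => by rcases hmem K hK with rfl | rfl <;> simp [hJ, hU])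
    (C := N * b + N * B * b) (by positivity)
    (by
      intro t ht
      have hfinJ : ∀ p ∈ block hN id t J.workload N fun _ => J, p.fin ≤ t + b := fun p hp => by
        simpa [hJ] using fin_le_of_mem_block (m := 1) J.workload_pos.le (fun _ => rfl) (by simp) hp
      have hfinU : ∀ p ∈ block hN id (b - B) U.workload (N * B) fun _ => U, p.fin ≤ b :=
        fun p hp => by
          simpa [hU] using fin_le_of_mem_block U.workload_pos.le (fun _ => rfl) le_rfl hp
      have hNb : b ≤ N * b := by nlinarith
      have hNBb : 0 ≤ N * B * b := by positivity
      have hstJ : ∀ p ∈ block hN id t J.workload N fun _ => J, t ≤ p.start := fun p hp =>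
        le_start_of_mem_block J.workload_pos.le hp
      refine ⟨block hN id t J.workload N (fun _ => J) ++
          block hN id (b - B) U.workload (N * B) fun _ => U, ?_, ?_, ?_, ?_, ?_⟩
      · rw [List.map_append, map_job_block, map_job_block]
      · refine (valid_block_const (hb.trans ht) Function.injective_id).append
          (valid_block_const le_rfl Function.injective_id) ?_
        intro p hp q hq _
        exact Or.inr ((hfinU q hq).trans (ht.trans (hstJ p hp)))
      · intro p hp
        rcases List.mem_append.1 hp with hp | hp
        · exact Or.inr (hstJ p hp)
        · exact Or.inl (hfinU p hp)
      · intro p hp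
        rcases List.mem_append.1 hp with hp | hp
        · linarith [hfinJ p hp]
        · linarith [hfinU p hp]
      · have h1 := sum_fin_sub_release_le hfinJ
        have h2 := sum_fin_sub_release_le hfinU
        rw [length_block] at h1 h2
        rw [List.map_append, List.sum_append]
        push_cast at h1 h2
        linarith)
    B
  refine (ENNReal.ofReal_le_ofReal (by linarith : b / 6 ≤ (B : ℝ) / 3)).trans (h ?_)
  rw [List.length_append, List.length_map, List.length_map, List.length_range, List.length_range,
    Finset.sum_range_add]
  have hval : ∀ q ∈ Finset.range (N * B), cap 1 (ω.residual (A.run ω) (N + q) b) = 1 := by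
    intro q hq
    have hq : q < N * B := by simpa using hq
    have hget : ω.jobs[N + q]? = some U := by
      rw [hX, List.append_assoc, List.getElem?_append_right (by simp),
        List.getElem?_append_left (by simpa using hq)]
      simp [hq]
    have h0 : (A.run ω).served (N + q, 0) b = 0 := by
      refine Schedule.served_eq_zero fun u hu m => ?_
      refine hA.run_ne_some hb0 (X := copies (N * B) U ++ X) (by rw [hX, List.append_assoc]) ?_ hu m
        (by omega)
      intro K hK
      rcases List.mem_append.1 hK with hK | hK
      · rw [eq_of_mem_copies hK]; simp only [hU, Job.single_release]; linarith
      · linarith [hXrel K hK]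
    simp [Input.residual, hget, h0, hU, cap]
  rw [Finset.sum_congr rfl hval]
  have : 0 ≤ ∑ i ∈ Finset.range N, cap 1 (ω.residual (A.run ω) i b) :=
    Finset.sum_nonneg fun i _ => cap_nonneg _ _
  simp only [Finset.sum_const, Finset.card_range, nsmul_eq_mul, mul_one]
  push_cast
  linarith

end

/-! ### The phases of the adversary -/

noncomputable section

/-- The starting time of phase `i`; phase `i` has length `2 * H i`. -/
def phaseStart (H : ℕ → ℕ) : ℕ → ℕ
  | 0 => 0
  | i + 1 => phaseStart H i + 2 * H i

section phases

variable {H : ℕ → ℕ} (hH : ∀ i, 0 < H i) (N : ℕ)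

/-- The long job of phase `i`. -/
def longJob (i : ℕ) : Job :=
  Job.single (phaseStart H i) (2 * H i) (by positivity) (by have := hH i; positivity) true

/-- The short job of phase `i`. -/
def shortJob (H : ℕ → ℕ) (i : ℕ) : Job :=
  Job.single (phaseStart H i) 1 (by positivity) one_pos true

/-- The jobs of phase `i`. -/
def phaseJobs (i : ℕ) : List Job :=
  copies (N / 2) (longJob hH i) ++ copies (N * H i) (shortJob H i)

/-- The jobs of the first `i` phases. -/
def phases : ℕ → List Job
  | 0 => []
  | i + 1 => phases i ++ phaseJobs hH N i

variable {hH N}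

lemma mem_phaseJobs {i : ℕ} {J : Job} (hJ : J ∈ phaseJobs hH N i) :
    J = longJob hH i ∨ J = shortJob H i :=
  (List.mem_append.1 hJ).imp eq_of_mem_copies eq_of_mem_copies

lemma release_of_mem_phaseJobs {i : ℕ} {J : Job} (hJ : J ∈ phaseJobs hH N i) :
    J.release = phaseStart H i := by
  rcases mem_phaseJobs hJ with rfl | rfl <;> rfl

lemma mem_phases {i : ℕ} {J : Job} (hJ : J ∈ phases hH N i) : ∃ j < i, J ∈ phaseJobs hH N j := by
  induction i with
  | zero => simp [phases] at hJ
  | succ i ih =>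
    rcases List.mem_append.1 hJ with hJ | hJ
    · obtain ⟨j, hj, h⟩ := ih hJ
      exact ⟨j, by omega, h⟩
    · exact ⟨i, by omega, hJ⟩

lemma phaseStart_mono : Monotone (phaseStart H) :=
  monotone_nat_of_le_succ fun i => by simp [phaseStart]

lemma release_le_of_mem_phases {i : ℕ} {J : Job} (hJ : J ∈ phases hH N (i + 1)) :
    J.release ≤ phaseStart H i := by
  obtain ⟨j, hj, h⟩ := mem_phases hJ
  rw [release_of_mem_phaseJobs h]
  exact_mod_cast phaseStart_mono (Nat.lt_succ_iff.1 hj)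

lemma pairwise_phases (i : ℕ) :
    (phases hH N i).Pairwise fun J K => J.release ≤ K.release := by
  induction i with
  | zero => simp [phases]
  | succ i ih =>
    refine List.pairwise_append.2 ⟨ih, List.pairwise_append.2
      ⟨pairwise_copies _ _, pairwise_copies _ _, fun J hJ K hK => ?_⟩, fun J hJ K hK => ?_⟩
    · rw [eq_of_mem_copies hJ, eq_of_mem_copies hK]
      exact le_rfl
    · rw [release_of_mem_phaseJobs hK]
      exact release_le_of_mem_phases (List.mem_append_left _ hJ)

lemma exists_phases_eq_append {i j : ℕ} (hij : i ≤ j) :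
    ∃ R, phases hH N j = phases hH N i ++ R ∧ ∀ J ∈ R, (phaseStart H i : ℝ) ≤ J.release := by
  induction j, hij using Nat.le_induction with
  | base => exact ⟨[], by simp, by simp⟩
  | succ j hij ih =>
    obtain ⟨R, hR, hR'⟩ := ih
    refine ⟨R ++ phaseJobs hH N j, by rw [phases, hR, List.append_assoc], fun J hJ => ?_⟩
    rcases List.mem_append.1 hJ with hJ | hJ
    · exact hR' J hJ
    · rw [release_of_mem_phaseJobs hJ]
      exact_mod_cast phaseStart_mono hij

lemma workload_of_mem_phases {a : ℝ} (ha : ∀ i, (2 * H i : ℝ) ≤ a) {i : ℕ} {J : Job}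
    (hJ : J ∈ phases hH N i) : 1 ≤ J.workload ∧ J.workload ≤ a := by
  obtain ⟨j, -, h⟩ := mem_phases hJ
  have h1 : (1 : ℝ) ≤ H j := by exact_mod_cast hH j
  rcases mem_phaseJobs h with rfl | rfl
  · simp only [longJob, Job.single_workload]
    exact ⟨by linarith, ha j⟩
  · simp only [shortJob, Job.single_workload]
    exact ⟨le_rfl, by linarith [ha j]⟩

lemma size_le_of_mem_phases {b : ℝ} {i : ℕ} {J : Job} (hJ : J ∈ phases hH N i) :
    ∀ τ ∈ J.tasks, τ.preemptive = false → τ.size ≤ b := by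
  obtain ⟨j, -, h⟩ := mem_phases hJ
  rcases mem_phaseJobs h with rfl | rfl <;> simp [longJob, shortJob]

section placement

open Placed

/-- The long jobs of phase `i`, started at time `t` on the first `N / 2` machines. -/
def placedLong (hH : ∀ i, 0 < H i) (hN : 0 < N / 2) (i : ℕ) (t : ℝ) : List (Placed N) :=
  block hN (Fin.castLE (Nat.div_le_self N 2)) t (longJob hH i).workload (N / 2)
    fun _ => longJob hH i

lemma valid_placedLong {hN : 0 < N / 2} {i : ℕ} {t : ℝ} (ht : phaseStart H i ≤ t) :
    Valid (placedLong hH hN i t) :=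
  valid_block_const ht (Fin.castLE_injective _)

lemma le_start_of_mem_placedLong {hN : 0 < N / 2} {i : ℕ} {t : ℝ} {p : Placed N}
    (hp : p ∈ placedLong hH hN i t) : t ≤ p.start :=
  le_start_of_mem_block (Job.workload_pos _).le hp

lemma fin_le_of_mem_placedLong {hN : 0 < N / 2} {i : ℕ} {t : ℝ} {p : Placed N}
    (hp : p ∈ placedLong hH hN i t) : p.fin ≤ t + 2 * H i := by
  simpa [longJob] using
    fin_le_of_mem_block (m := 1) (Job.workload_pos _).le (fun _ => rfl) (by simp) hp

/-- The jobs of the first `i` phases can be completed by the end of phase `i`. -/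
lemma exists_placed_phases (hN : 0 < N / 2) (i : ℕ) : ∃ L : List (Placed N),
    L.map job = phases hH N i ∧ Valid L ∧ ∀ p ∈ L, p.fin ≤ phaseStart H i := by
  induction i with
  | zero => exact ⟨[], rfl, ⟨by simp, by simp⟩, by simp⟩
  | succ i ih =>
    obtain ⟨L, hL, hv, hfin⟩ := ih
    have hw : 0 < N - N / 2 := by omega
    set f : Fin (N - N / 2) → Fin N := fun j => ⟨N / 2 + j, by omega⟩ with hf
    have hfinj : Function.Injective f := by
      intro j j' h
      simp only [hf, Fin.mk.injEq] at h
      exact Fin.ext (by omega)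
    set Lo := placedLong hH hN i (phaseStart H i) with hLo
    set Sh := block hw f (phaseStart H i) (shortJob H i).workload (N * H i)
      (fun _ => shortJob H i) with hSh
    have hSh1 : ∀ p ∈ Sh, (phaseStart H i : ℝ) ≤ p.start := fun p hp =>
      le_start_of_mem_block (Job.workload_pos _).le hp
    -- The N - ⌊N/2⌋ ≥ N/2 machines without long jobs have room for N H_i unit jobs in time 2 H_i.
    have hSh2 : ∀ p ∈ Sh, p.fin ≤ phaseStart H i + 2 * H i := fun p hp => by
      simpa [shortJob] using fin_le_of_mem_block (m := 2 * H i) (Job.workload_pos _).le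
        (fun _ => rfl) (by rw [← mul_assoc]; exact Nat.mul_le_mul_right _ (by omega)) hp
    have hcast : ((phaseStart H (i + 1) : ℕ) : ℝ) = phaseStart H i + 2 * H i := by
      simp [phaseStart]
    refine ⟨L ++ (Lo ++ Sh), ?_, hv.append ((valid_placedLong le_rfl).append
      (valid_block_const le_rfl hfinj) ?_) ?_, ?_⟩
    · rw [List.map_append, List.map_append, hL, hLo, placedLong, hSh, map_job_block, map_job_block]
      rfl
    · intro p hp q hq hpq
      exfalso
      obtain ⟨x, hx⟩ := mach_mem_range_of_mem_block hp
      obtain ⟨y, hy⟩ := mach_mem_range_of_mem_block hq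
      have := congrArg Fin.val (hx.trans (hpq.trans hy.symm))
      simp only [hf, Fin.val_castLE] at this
      omega
    · intro p hp q hq _
      left
      rcases List.mem_append.1 hq with hq | hq
      · exact (hfin p hp).trans (le_start_of_mem_placedLong hq)
      · exact (hfin p hp).trans (hSh1 q hq)
    · intro p hp
      rw [hcast]
      rcases List.mem_append.1 hp with hp | hp
      · have : (0 : ℝ) ≤ H i := by positivity
        linarith [hfin p hp]
      · rcases List.mem_append.1 hp with hp | hp
        · exact fin_le_of_mem_placedLong hp
        · exact hSh2 p hp

/-- All jobs of the first `i + 1` phases except for the long ones of the last phase can be completed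
by the middle of the last phase. -/
lemma exists_placed_phases_mid (hN : 0 < N / 2) (i : ℕ) {t : ℝ} (ht : phaseStart H i + H i ≤ t) :
    ∃ L : List (Placed N), L.map job = phases hH N (i + 1) ∧ Valid L ∧
      (∀ p ∈ L, p.fin ≤ phaseStart H i + H i ∨ t ≤ p.start) ∧
      (∀ p ∈ L, p.fin ≤ t + 2 * H i) ∧
      (L.map fun p => p.fin - p.job.release).sum
        ≤ (phases hH N (i + 1)).length * (phaseStart H i + H i) + N * (t + 2 * H i) := by
  obtain ⟨L, hL, hv, hfin⟩ := exists_placed_phases (hH := hH) hN i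
  have hN0 : 0 < N := by omega
  have hH0 : (0 : ℝ) ≤ H i := by positivity
  have hT0 : (0 : ℝ) ≤ phaseStart H i := by positivity
  set Lo := placedLong hH hN i t with hLo
  set Sh := block hN0 id (phaseStart H i) (shortJob H i).workload (N * H i)
    (fun _ => shortJob H i) with hSh
  have hSh1 : ∀ p ∈ Sh, (phaseStart H i : ℝ) ≤ p.start := fun p hp =>
    le_start_of_mem_block (Job.workload_pos _).le hp
  have hSh2 : ∀ p ∈ Sh, p.fin ≤ phaseStart H i + H i := fun p hp => by
    simpa [shortJob] using fin_le_of_mem_block (Job.workload_pos _).le (fun _ => rfl) le_rfl hp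
  have hL2 : ∀ p ∈ L, p.fin ≤ phaseStart H i + H i := fun p hp => by linarith [hfin p hp]
  have hLo1 : ∀ p ∈ Lo, t ≤ p.start := fun p hp => le_start_of_mem_placedLong hp
  have hLo2 : ∀ p ∈ Lo, p.fin ≤ t + 2 * H i := fun p hp => fin_le_of_mem_placedLong hp
  have hmap : (L ++ (Lo ++ Sh)).map job = phases hH N (i + 1) := by
    rw [List.map_append, List.map_append, hL, hLo, placedLong, hSh, map_job_block, map_job_block]
    rfl
  refine ⟨L ++ (Lo ++ Sh), hmap, hv.append ((valid_placedLong (by linarith)).append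
      (valid_block_const le_rfl Function.injective_id) ?_) ?_, ?_, ?_, ?_⟩
  · intro p hp q hq _
    exact Or.inr ((hSh2 q hq).trans (ht.trans (hLo1 p hp)))
  · intro p hp q hq _
    left
    rcases List.mem_append.1 hq with hq | hq
    · exact (hL2 p hp).trans (ht.trans (hLo1 q hq))
    · exact (hfin p hp).trans (hSh1 q hq)
  · intro p hp
    rcases List.mem_append.1 hp with hp | hp
    · exact Or.inl (hL2 p hp)
    · rcases List.mem_append.1 hp with hp | hp
      · exact Or.inr (hLo1 p hp)
      · exact Or.inl (hSh2 p hp)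
  · intro p hp
    rcases List.mem_append.1 hp with hp | hp
    · linarith [hL2 p hp]
    · rcases List.mem_append.1 hp with hp | hp
      · exact hLo2 p hp
      · linarith [hSh2 p hp]
  · have h1 := sum_fin_sub_release_le hL2
    have h2 := sum_fin_sub_release_le hLo2
    have h3 := sum_fin_sub_release_le hSh2
    have hlen : ((phases hH N (i + 1)).length : ℝ) = L.length + (Lo.length + Sh.length) := by
      rw [← hmap]; simp
    have hLolen : (Lo.length : ℝ) ≤ N := by
      rw [hLo, placedLong, length_block]
      exact_mod_cast Nat.div_le_self N 2
    have h4 : (Lo.length : ℝ) * (t + 2 * H i) ≤ N * (t + 2 * H i) :=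
      mul_le_mul_of_nonneg_right hLolen (by linarith)
    have h5 : 0 ≤ (Lo.length : ℝ) * (phaseStart H i + H i) := by positivity
    rw [List.map_append, List.map_append, List.sum_append, List.sum_append, hlen]
    linarith

end placement

/-- If the algorithm completes almost all short jobs in the first half of phase `i`, then phase `i`
adds to the backlog. -/
lemma Schedule.Feasible.backlog_succ {parallel : Bool} {ω : Input} {S : Schedule N}
    (hS : S.Feasible parallel ω) {i : ℕ} {X : List Job} (hω : ω.jobs = phases hH N (i + 1) ++ X)
    {κ : ℝ} (hκ : ∑ k ∈ Finset.range (phases hH N (i + 1)).length,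
      cap 1 (ω.residual S k (phaseStart H i + H i)) ≤ κ) :
    (∑ k ∈ Finset.range (phases hH N i).length,
        cap (12 * H i) (ω.residual S k (phaseStart H i))) / 12
        + (N / 2 : ℕ) * H i - κ - N * H i / 12
      ≤ ∑ k ∈ Finset.range (phases hH N (i + 1)).length,
        cap (H i) (ω.residual S k (phaseStart H (i + 1))) := by
  have hH0 : (0 : ℝ) ≤ H i := by positivity
  have hT0 : (0 : ℝ) ≤ phaseStart H i := by positivity
  have hcast : ((phaseStart H (i + 1) : ℕ) : ℝ) = phaseStart H i + 2 * H i := by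
    simp [phaseStart]
  rw [hcast]
  set T : ℝ := ((phaseStart H i : ℕ) : ℝ) with hT
  set n := (phases hH N i).length with hn
  set h := N / 2 with hh
  have hlen : (phases hH N (i + 1)).length = n + h + N * H i := by
    simp [phases, phaseJobs, hn, hh, add_assoc]
  have hlong : ∀ j < h, ω.jobs[n + j]? = some (longJob hH i) := by
    intro j hj
    rw [hω, phases, phaseJobs, List.append_assoc, List.append_assoc,
      List.getElem?_append_right (by omega), Nat.add_sub_cancel_left,
      List.getElem?_append_left (by simpa using hj)]
    simp [hj.trans_eq hh]
  have hshort : ∀ q < N * H i, ω.jobs[n + h + q]? = some (shortJob H i) := by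
    intro q hq
    rw [hω, phases, phaseJobs, List.append_assoc, List.append_assoc,
      List.getElem?_append_right (by omega), add_assoc, Nat.add_sub_cancel_left,
      List.getElem?_append_right (by simp [hh]),
      List.getElem?_append_left (by simpa [hh] using hq)]
    simp [hh, hq]
  have hlong0 : ∀ j < h, S.served (n + j, 0) T = 0 := fun j hj =>
    hS.served_eq_zero_of_le_release (hlong j hj) le_rfl
  have hshort0 : ∀ q < N * H i, S.served (n + h + q, 0) T = 0 := fun q hq =>
    hS.served_eq_zero_of_le_release (hshort q hq) le_rfl
  have hfirst := hS.sum_served_sub_le (Finset.range (n + h + N * H i)) hT0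
    (by linarith : T ≤ T + H i)
  have hsecond := hS.sum_served_sub_le (Finset.range n) (by linarith : 0 ≤ T + H i)
    (by linarith : T + H i ≤ T + 2 * H i)
  rw [Finset.sum_range_add, Finset.sum_range_add] at hfirst
  rw [hlen, Finset.sum_range_add, Finset.sum_range_add] at hκ
  rw [hlen, Finset.sum_range_add, Finset.sum_range_add]
  -- Service missing from the unit jobs shows up in their capped residuals, so it is at most κ.
  -- Hence old and long jobs together receive at most κ in the first half.
  have hb : N * H i - ∑ q ∈ Finset.range (N * H i),
        (S.served (n + h + q, 0) (T + H i) - S.served (n + h + q, 0) T)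
      ≤ ∑ q ∈ Finset.range (N * H i), cap 1 (ω.residual S (n + h + q) (T + H i)) := by
    have : (N * H i : ℝ) = ∑ q ∈ Finset.range (N * H i), (1 : ℝ) := by simp
    rw [this, ← Finset.sum_sub_distrib]
    refine Finset.sum_le_sum fun q hq => ?_
    have hq := Finset.mem_range.1 hq
    have hres : ω.residual S (n + h + q) (T + H i) = 1 - S.served (n + h + q, 0) (T + H i) := by
      simp [Input.residual, hshort q hq, shortJob]
    rw [hshort0 q hq, sub_zero, hres]
    exact le_cap (by linarith [Schedule.served_nonneg (S := S) (n + h + q, 0) (T + H i)])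
  have hκ1 : 0 ≤ ∑ k ∈ Finset.range n, cap 1 (ω.residual S k (T + H i)) :=
    Finset.sum_nonneg fun _ _ => cap_nonneg _ _
  have hκ2 : 0 ≤ ∑ j ∈ Finset.range h, cap 1 (ω.residual S (n + j) (T + H i)) :=
    Finset.sum_nonneg fun _ _ => cap_nonneg _ _
  -- A job of length 2 H_i receives at most H_i in the second half, so it ends with at least H_i
  -- minus its first-half service.
  have hnew : h * H i - ∑ j ∈ Finset.range h,
        (S.served (n + j, 0) (T + H i) - S.served (n + j, 0) T)
      ≤ ∑ j ∈ Finset.range h, cap (H i) (ω.residual S (n + j) (T + 2 * H i)) := by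
    have : (h * H i : ℝ) = ∑ j ∈ Finset.range h, (H i : ℝ) := by simp
    rw [this, ← Finset.sum_sub_distrib]
    refine Finset.sum_le_sum fun j hj => ?_
    have hj := Finset.mem_range.1 hj
    have hres : ω.residual S (n + j) (T + 2 * H i)
        = 2 * H i - S.served (n + j, 0) (T + 2 * H i) := by
      simp [Input.residual, hlong j hj, longJob]
    have h1 := Schedule.served_le_add (S := S) (n + j, 0) (by linarith : 0 ≤ T + H i)
      (by linarith : T + H i ≤ T + 2 * H i)
    rw [hlong0 j hj, sub_zero, hres]
    refine (le_cap (by linarith [Schedule.served_nonneg (S := S) (n + j, 0) (T + H i)])).trans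
      (cap_mono ?_)
    linarith
  -- In the second half the old jobs lose at most N H_i of capped residual. Lowering the cap from 12
  -- H_i to H_i divides both the backlog and this loss by 12.
  have hold := Schedule.sub_sum_served_le_sum_cap (S := S) (ω := ω) (Finset.range n) (12 * H i)
    hT0 (by linarith : T ≤ T + 2 * H i)
  have hold2 : ∑ k ∈ Finset.range n, cap (12 * H i) (ω.residual S k (T + 2 * H i))
      ≤ 12 * ∑ k ∈ Finset.range n, cap (H i) (ω.residual S k (T + 2 * H i)) := by
    rw [Finset.mul_sum]
    exact Finset.sum_le_sum fun k _ => cap_le_mul_cap (by norm_num) _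
  have hsplit : ∑ k ∈ Finset.range n, (S.served (k, 0) (T + 2 * H i) - S.served (k, 0) T)
      = ∑ k ∈ Finset.range n, (S.served (k, 0) (T + H i) - S.served (k, 0) T)
        + ∑ k ∈ Finset.range n,
          (S.served (k, 0) (T + 2 * H i) - S.served (k, 0) (T + H i)) := by
    rw [← Finset.sum_add_distrib]
    exact Finset.sum_congr rfl fun _ _ => by ring
  have hd1 : 0 ≤ ∑ k ∈ Finset.range n, (S.served (k, 0) (T + H i) - S.served (k, 0) T) :=
    Finset.sum_nonneg fun k _ => sub_nonneg.2 (Schedule.served_mono _ hT0 (by linarith))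
  have hrest : 0 ≤ ∑ q ∈ Finset.range (N * H i),
      cap (H i) (ω.residual S (n + h + q) (T + 2 * H i)) :=
    Finset.sum_nonneg fun _ _ => cap_nonneg _ _
  linarith

end phases

end

/-! ### The logarithmic bound -/

noncomputable section

variable {parallel : Bool} {N : ℕ} {a b : ℝ}

/-- The half-lengths of the `K` phases of the adversary. -/
def halfLength (K i : ℕ) : ℕ := K * 12 ^ (K - i)

lemma halfLength_pos {K : ℕ} (hK : 0 < K) (i : ℕ) : 0 < halfLength K i := by
  unfold halfLength; positivity

lemma halfLength_le (K i : ℕ) : halfLength K i ≤ K * 12 ^ K :=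
  Nat.mul_le_mul_left _ (Nat.pow_le_pow_right (by norm_num) (Nat.sub_le K i))

lemma halfLength_succ {K i : ℕ} (hi : i < K) : halfLength K i = 12 * halfLength K (i + 1) := by
  unfold halfLength
  have : K - i = K - (i + 1) + 1 := by omega
  rw [this, pow_succ]
  ring

/-- This is what the factor K in `halfLength` is for: it makes the tolerated mid-phase backlog K N
at most N H_i / 12. -/
lemma le_halfLength {K i : ℕ} (hi : i < K) : 12 * K ≤ halfLength K i := by
  rw [halfLength_succ hi]
  exact Nat.mul_le_mul_left _ (Nat.le_mul_of_pos_right _ (by positivity))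

/-- If the algorithm completes almost all short jobs in the first half of each phase, then about
half of the long jobs are still alive after the last phase. -/
lemma Schedule.Feasible.backlog_phases (hN : 2 ≤ N) {ω : Input} {S : Schedule N}
    (hS : S.Feasible parallel ω) {K : ℕ} (hK : 0 < K) {X : List Job}
    (hω : ω.jobs = phases (halfLength_pos hK) N K ++ X)
    (hκ : ∀ i < K, ∑ k ∈ Finset.range (phases (halfLength_pos hK) N (i + 1)).length,
      cap 1 (ω.residual S k (phaseStart (halfLength K) i + halfLength K i)) ≤ K * N) {i : ℕ}
    (hi : i ≤ K) :
    12 * halfLength K i * (N / 2 : ℕ) * (i / 2 : ℝ)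
      ≤ ∑ k ∈ Finset.range (phases (halfLength_pos hK) N i).length,
        cap (12 * halfLength K i) (ω.residual S k (phaseStart (halfLength K) i)) := by
  induction i with
  | zero => simp [phases]
  | succ i ih =>
    have hiK : i < K := hi
    obtain ⟨R, hR, -⟩ := exists_phases_eq_append (hH := halfLength_pos hK) (N := N) hi
    have hstep := hS.backlog_succ (X := R ++ X) (by rw [hω, hR, List.append_assoc]) (hκ i hiK)
    have hIH := ih hiK.le
    have hH : (12 * halfLength K (i + 1) : ℝ) = halfLength K i := by
      rw [halfLength_succ hiK]; push_cast; ring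
    have h12 : (12 * K : ℝ) ≤ halfLength K i := by exact_mod_cast le_halfLength hiK
    -- Equality holds at N = 3. The losses K N and N H_i / 12 are then each at most a quarter of the
    -- gain ⌊N/2⌋ H_i, so every phase nets half of it.
    have hN3 : (N : ℝ) ≤ 3 * (N / 2 : ℕ) := by exact_mod_cast (by omega : N ≤ 3 * (N / 2))
    rw [hH]
    have h1 : (K : ℝ) * N ≤ halfLength K i / 12 * (3 * (N / 2 : ℕ)) := by gcongr; linarith
    have h2 : (N : ℝ) * halfLength K i ≤ 3 * (N / 2 : ℕ) * halfLength K i := by gcongr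
    refine le_trans ?_ hstep
    push_cast
    linarith

open Placed in
lemma OnlineAlgorithm.div_le_competitiveRatio_of_phases (hN : 2 ≤ N)
    (A : OnlineAlgorithm parallel N) (ha : 1 ≤ a) (hb : 0 ≤ b) (hba : b ≤ a) {K : ℕ} (hK : 0 < K)
    (hKa : 2 * (K * 12 ^ K : ℝ) ≤ a) :
    ENNReal.ofReal (K / 18) ≤ A.competitiveRatio {ω : Input | ω.alpha = a ∧ ω.beta = b} := by
  have hN0 : 0 < N := by omega
  have hN2 : 0 < N / 2 := by omega
  set hH := halfLength_pos hK
  set T : ℕ → ℝ := fun i => phaseStart (halfLength K) i with hT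
  have hTmono : Monotone T := fun i j hij =>
    Nat.cast_le.2 (phaseStart_mono hij)
  have hHa : ∀ i, (2 * halfLength K i : ℝ) ≤ a := fun i => by
    have : (halfLength K i : ℝ) ≤ K * 12 ^ K := by exact_mod_cast halfLength_le K i
    linarith
  have hT0 : ∀ i, 0 ≤ T i := fun i => by positivity
  have hTsucc : ∀ i, T (i + 1) = T i + 2 * halfLength K i := fun i => by simp [hT, phaseStart]
  have hH0 : ∀ i, (0 : ℝ) ≤ halfLength K i := fun i => by positivity
  obtain ⟨ω, -, -, ⟨X, hX, hXrel⟩, hend⟩ := exists_input_of_backlog hN0 A ha hb hba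
    (base := phases hH N K) (T := T K) (hT0 K) (pairwise_phases K)
    (fun J hJ => by
      obtain ⟨j, hj, h⟩ := mem_phases hJ
      rw [release_of_mem_phaseJobs h]
      exact hTmono hj.le)
    (fun J hJ => workload_of_mem_phases hHa hJ) (fun J hJ => size_le_of_mem_phases hJ)
    (C := (phases hH N K).length * T K) (mul_nonneg (by positivity) (hT0 K))
    (by
      intro t ht
      have hC : 0 ≤ (phases hH N K).length * T K := mul_nonneg (by positivity) (hT0 K)
      have hNt : 0 ≤ N * t := mul_nonneg (by positivity) ((hT0 K).trans ht)
      obtain ⟨L, hL, hv, hfin⟩ := exists_placed_phases (hH := hH) hN2 K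
      refine ⟨L, hL, hv, fun p hp => Or.inl (hfin p hp), fun p hp => ?_, ?_⟩
      · have : p.fin ≤ T K := hfin p hp
        linarith
      · have h1 : _ ≤ L.length * T K := sum_fin_sub_release_le hfin
        have hlen : (phases hH N K).length = L.length := by rw [← hL, List.length_map]
        rw [hlen]
        linarith)
    (K / 6)
  by_cases hmid : ∃ i < K, (K * N : ℝ) < ∑ k ∈ Finset.range (phases hH N (i + 1)).length,
      cap 1 (ω.residual (A.run ω) k (T i + halfLength K i))
  · obtain ⟨i, hi, hback⟩ := hmid
    have hTi : 0 ≤ T i + halfLength K i := add_nonneg (hT0 i) (hH0 i)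
    set n := (phases hH N (i + 1)).length with hn
    have hnT : 0 ≤ n * (T i + halfLength K i) := mul_nonneg (by positivity) hTi
    have hNH : 2 * (halfLength K i : ℝ) ≤ N * (2 * halfLength K i) := by
      have : (1 : ℝ) ≤ N := by exact_mod_cast hN0
      nlinarith [hH0 i]
    obtain ⟨ω', -, -, ⟨X', hX', hXrel'⟩, hend'⟩ := exists_input_of_backlog hN0 A ha hb hba
      (base := phases hH N (i + 1)) (T := T i + halfLength K i) hTi (pairwise_phases _)
      (fun J hJ => (release_le_of_mem_phases hJ).trans (le_add_of_nonneg_right (hH0 i)))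
      (fun J hJ => workload_of_mem_phases hHa hJ) (fun J hJ => size_le_of_mem_phases hJ)
      (C := n * (T i + halfLength K i) + N * (2 * halfLength K i))
      (add_nonneg hnT (by positivity))
      (by
        intro t ht
        obtain ⟨L, hL, hv, h1, h2, h3⟩ := exists_placed_phases_mid (hH := hH) hN2 i ht
        exact ⟨L, hL, hv, h1, fun p hp => by linarith [h2 p hp], h3.trans (by linarith)⟩)
      K
    refine (ENNReal.ofReal_le_ofReal (by linarith [Nat.cast_nonneg (α := ℝ) K])).trans (hend' ?_)
    refine hback.le.trans (le_of_eq (Finset.sum_congr rfl fun k hk => ?_))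
    obtain ⟨R, hR, hRrel⟩ := exists_phases_eq_append (hH := hH) (N := N) (Nat.succ_le_of_lt hi)
    -- Up to the middle of phase i the algorithm cannot tell the full input from the one whose
    -- stream starts there, so the backlog is the same.
    rw [A.residual_eq_of_append (X := R ++ X) (by rw [hX, hR, List.append_assoc]) hX' ?_ hXrel'
      (Finset.mem_range.1 hk)]
    have hle : T i + halfLength K i ≤ T (i + 1) := by linarith [hTsucc i, hH0 i]
    intro J hJ
    rcases List.mem_append.1 hJ with hJ | hJ
    · exact hle.trans (hRrel J hJ)
    · refine hle.trans (le_trans ?_ (hXrel J hJ))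
      exact hTmono hi
  · push Not at hmid
    refine (ENNReal.ofReal_le_ofReal (by linarith)).trans (hend ?_)
    have hback := (A.feasible ω).backlog_phases hN hK hX hmid le_rfl
    have hHK : (1 : ℝ) ≤ halfLength K K := by exact_mod_cast hH K
    -- Lowering the cap to 1 costs exactly the factor 12 H_K present in `backlog_phases`. This
    -- leaves ⌊N/2⌋ K / 2 ≥ K N / 6, that is, θ = K / 6.
    have hcap : ∑ k ∈ Finset.range (phases hH N K).length,
          cap (12 * halfLength K K) (ω.residual (A.run ω) k (T K))
        ≤ 12 * halfLength K K * ∑ k ∈ Finset.range (phases hH N K).length,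
          cap 1 (ω.residual (A.run ω) k (T K)) := by
      rw [Finset.mul_sum]
      refine Finset.sum_le_sum fun k _ => ?_
      have := cap_le_mul_cap (c := 1) (by linarith : (1 : ℝ) ≤ 12 * halfLength K K)
        (ω.residual (A.run ω) k (T K))
      rwa [mul_one] at this
    have hmul := hback.trans hcap
    rw [mul_assoc] at hmul
    have hcancel := le_of_mul_le_mul_left hmul (by linarith)
    refine le_trans ?_ hcancel
    have hN3 : (N : ℝ) ≤ 3 * (N / 2 : ℕ) := by exact_mod_cast (by omega : N ≤ 3 * (N / 2))
    nlinarith [Nat.cast_nonneg (α := ℝ) K]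

/-- With K = ⌊log a / 4⌋ phases, 2 K 12^K ≤ 24^K ≤ e^(4K) ≤ a. For K ≥ 1, log a / 4 < K + 1 ≤ 2 K
turns K / 18 into log a / 144; for K = 0 the bound 1/3 suffices. -/
lemma OnlineAlgorithm.log_le_competitiveRatio (hN : 2 ≤ N) (A : OnlineAlgorithm parallel N)
    (ha : 1 ≤ a) (hb : 0 ≤ b) (hba : b ≤ a) :
    ENNReal.ofReal (Real.log a / 144)
      ≤ A.competitiveRatio {ω : Input | ω.alpha = a ∧ ω.beta = b} := by
  have hlog : 0 ≤ Real.log a := Real.log_nonneg ha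
  set K := ⌊Real.log a / 4⌋₊ with hKdef
  have hK1 : (K : ℝ) ≤ Real.log a / 4 := Nat.floor_le (by positivity)
  have hK2 : Real.log a / 4 < K + 1 := Nat.lt_floor_add_one _
  rcases Nat.eq_zero_or_pos K with h0 | hK
  · refine (ENNReal.ofReal_le_ofReal ?_).trans
      (A.one_third_le_competitiveRatio (by omega) ha hb hba)
    rw [h0] at hK2
    push_cast at hK2
    linarith
  · have hKr : (1 : ℝ) ≤ K := by exact_mod_cast hK
    refine (ENNReal.ofReal_le_ofReal (by linarith)).trans
      (A.div_le_competitiveRatio_of_phases hN ha hb hba hK ?_)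
    have h2K : 2 * K ≤ 2 ^ K := by
      obtain ⟨k, hk⟩ := Nat.exists_eq_succ_of_ne_zero hK.ne'
      rw [hk, Nat.succ_eq_add_one, pow_succ]
      have := Nat.lt_two_pow_self (n := k)
      omega
    have h2K' : (2 * K : ℝ) ≤ 2 ^ K := by exact_mod_cast h2K
    have he : (24 : ℝ) ≤ Real.exp 4 := by
      have h1 : (2.7 : ℝ) ≤ Real.exp 1 := by linarith [Real.exp_one_gt_d9]
      have h4 : Real.exp 4 = Real.exp 1 ^ 4 := by
        rw [← Real.exp_nat_mul]; norm_num
      rw [h4]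
      calc (24 : ℝ) ≤ 2.7 ^ 4 := by norm_num
        _ ≤ _ := by gcongr
    calc 2 * (K * 12 ^ K : ℝ) = 2 * K * 12 ^ K := by ring
      _ ≤ 2 ^ K * 12 ^ K := by gcongr
      _ = 24 ^ K := by rw [← mul_pow]; norm_num
      _ ≤ Real.exp 4 ^ K := by gcongr
      _ = Real.exp (K * 4) := by rw [Real.exp_nat_mul]
      _ ≤ Real.exp (Real.log a) := Real.exp_le_exp.2 (by linarith)
      _ = a := Real.exp_log (by linarith)

end

end MPMS

/-! ### Combination of the three bounds -/

theorem mainTheorem7 (ε : ℝ) (hε : 0 < ε) :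
    ∃ c : ℝ, 0 < c ∧
      ∀ (parallel : Bool) (N : ℕ), 2 ≤ N →
      ∀ A : MPMS.OnlineAlgorithm parallel N, A.WorkConserving →
      ∀ a b : ℝ, 1 ≤ a → 0 ≤ b → b ≤ a → (ε ≤ 1 ∨ 1 ≤ b) →
        ENNReal.ofReal (c * (Real.log a + b ^ (1 - ε))) ≤
          A.competitiveRatio {ω : MPMS.Input | ω.alpha = a ∧ ω.beta = b} := by
  -- If M is the maximum of the three bounds, then log a ≤ 144 M and max 1 b ≤ 6 M, so already 1/150
  -- would do.
  refine ⟨1 / 300, by norm_num, fun parallel N hN A hA a b ha hb hba hεb => ?_⟩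
  have h1 := A.one_third_le_competitiveRatio (by omega) ha hb hba
  have h2 := hA.div_six_le_competitiveRatio (by omega) ha hb hba
  have h3 := A.log_le_competitiveRatio hN ha hb hba
  have hpow : b ^ (1 - ε) ≤ max 1 b := by
    rcases le_total 1 b with hb1 | hb1
    · refine le_max_of_le_right ?_
      calc b ^ (1 - ε) ≤ b ^ (1 : ℝ) := Real.rpow_le_rpow_of_exponent_le hb1 (by linarith)
        _ = b := Real.rpow_one b
    · refine le_max_of_le_left ?_
      -- For 0 < b < 1 and ε > 1 the power would be unbounded; the hypothesis leaves only ε ≤ 1 or b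
      -- = 1 here.
      rcases hεb with hε1 | hb1'
      · exact Real.rpow_le_one hb hb1 (by linarith)
      · rw [le_antisymm hb1 hb1', Real.one_rpow]
  have h4 : ENNReal.ofReal (max (Real.log a / 144) (max (1 / 3) (b / 6)))
      ≤ A.competitiveRatio {ω : MPMS.Input | ω.alpha = a ∧ ω.beta = b} := by
    rw [ENNReal.ofReal_max, ENNReal.ofReal_max]
    exact max_le h3 (max_le h1 h2)
  refine (ENNReal.ofReal_le_ofReal ?_).trans h4
  have h5 := le_max_left (Real.log a / 144) (max (1 / 3) (b / 6))
  have h6 := (le_max_left (1 / 3) (b / 6)).trans (le_max_right (Real.log a / 144) _)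
  have h7 := (le_max_right (1 / 3) (b / 6)).trans (le_max_right (Real.log a / 144) _)
  rcases le_total 1 b with hb1 | hb1
  · rw [max_eq_right hb1] at hpow
    linarith
  · rw [max_eq_left hb1] at hpow
    linarith
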